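/- Let $\Bbbk$ be a field of characteristic $0$. Let $W$ be the Witt algebra over $\Bbbk$, i.e. the Lie algebra with basis $\{e_n\}_{n\in\mathbb Z}$ and bracket $[e_n,e_m]=(m-n)e_{n+m}$, let $W_+$ be its Lie subalgebra generated by $\{e_n\}_{n\ge 1}$, and let $U(W_+)$ be the universal enveloping algebra of $W_+$, graded by $\deg e_n=n$. Let $$S=\Bbbk\langle u,v,w\rangle/(uv-vu-v^2,\ uw-wu-vw,\ vw-wv),\qquad R=\Bbbk\langle u,v\rangle/(uv-vu-v^2),$$ where $R=\bigoplus_{n\ge 0}R_n$ is graded by $\deg u=\deg v=1$, and put $R_{\ge n}=\bigoplus_{m\ge n}R_m$. Let $\phi:U(W_+)\to S$ and, for $a\in\Bbbk$, $\lambda_a:U(W_+)\to R$ be the $\Bbbk$-algebra homomorphisms determined by $$\phi(e_n)=(u-(n-1)w)v^{n-1},\qquad \lambda_a(e_n)=(u-(n-1)av)v^{n-1}\qquad(n\ge 1).$$ Below, $(x_1,\dots,x_r)$ denotes the two-sided ideal generated by $x_1,\dots,x_r$, and noetherian means left and right noetherian. Then the following hold. (a) If $a\in\{0,1\}$, then $\ker\lambda_a=(e_1e_3-e_2^2-e_4)$.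 If $a\ne 0,1$, then $\ker\lambda_a=(h_1,h_2,h_3)$, where \begin{align*} h_1&=e_1e_2^2-e_1^2e_3-2a\,e_2e_3+(1+2a)e_1e_4-(a^2+a)e_5,\\ h_2&=e_1e_5-4e_2e_4+3e_3^2+2e_6,\\ h_3&=-4e_1^2e_2^2-4e_2^3+4e_1^3e_3+(20a^2+14a-7)e_3^2-(16a^2+18a+5)e_1e_5+(16a^3+36a^2+16a-2)e_6, \end{align*} and $h_1$ is homogeneous of degree $5$, while $h_2$ and $h_3$ are homogeneous of degree $6$. (b) $\lambda_0(U(W_+))=\Bbbk+uR$, $\lambda_1(U(W_+))=\Bbbk+Ru$, and $\lambda_a(U(W_+))\supseteq R_{\ge 4}$ if $a\ne 0,1$. For every $a\in\Bbbk$, the ring $\lambda_a(U(W_+))$ is noetherian. (c) $\ker\phi=(e_1e_5-4e_2e_4+3e_3^2+2e_6)$. -/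

import Mathlib

/-! ### The Witt algebra and its positive part -/

/-- The underlying vector space of the Witt algebra, with basis `e n`, `n : ℤ`. -/
def Witt (k : Type*) [Field k] : Type _ := ℤ →₀ k

namespace Witt

noncomputable section

variable (k : Type*) [Field k]

instance : AddCommGroup (Witt k) := inferInstanceAs (AddCommGroup (ℤ →₀ k))

instance : Module k (Witt k) := inferInstanceAs (Module k (ℤ →₀ k))

/-- The basis `e n`, `n : ℤ`, of the Witt algebra. -/
def basis : Module.Basis ℤ k (Witt k) := Module.Basis.ofRepr (LinearEquiv.refl k (ℤ →₀ k))

/-- The basis vector `e n`. -/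
def e (n : ℤ) : Witt k := basis k n

/-- The bilinear map with `(e n, e m) ↦ (m - n) e (n + m)`. -/
def bracket : Witt k →ₗ[k] Witt k →ₗ[k] Witt k :=
  (basis k).constr k fun n => (basis k).constr k fun m => ((m : k) - (n : k)) • e k (n + m)

theorem bracket_e (n m : ℤ) : bracket k (e k n) (e k m) = ((m : k) - (n : k)) • e k (n + m) := by
  simp [bracket, e]

variable {k} in
theorem induction_basis {P : Witt k → Prop} (x : Witt k) (zero : P 0)
    (add : ∀ x y, P x → P y → P (x + y)) (smul : ∀ (c : k) (x), P x → P (c • x))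
    (coe : ∀ n, P (e k n)) : P x := by
  have hx : x ∈ Submodule.span k (Set.range (basis k)) := by simp
  induction hx using Submodule.span_induction with
  | zero => exact zero
  | add x y _ _ hx hy => exact add x y hx hy
  | smul c x _ hx => exact smul c x hx
  | mem x hx =>
    obtain ⟨n, rfl⟩ := hx
    exact coe n

theorem bracket_self (x : Witt k) : bracket k x x = 0 := by
  have hanti : ∀ x y : Witt k, bracket k x y + bracket k y x = 0 := by
    have h : bracket k + (bracket k).flip = 0 := by
      refine (basis k).ext fun n => (basis k).ext fun m => ?_
      change bracket k (e k n) (e k m) + bracket k (e k m) (e k n) = 0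
      rw [bracket_e, bracket_e, add_comm m n, ← add_smul]
      simp
    intro x y
    exact LinearMap.congr_fun (LinearMap.congr_fun h x) y
  induction x using induction_basis with
  | zero => simp
  | coe n =>
    change bracket k (e k n) (e k n) = 0
    rw [bracket_e]
    simp
  | add x y hx hy =>
    have := hanti x y
    simp only [map_add, LinearMap.add_apply, hx, hy, zero_add, add_zero]
    rw [add_comm]
    exact this
  | smul c x hx => simp [hx]

theorem bracket_leibniz (x y z : Witt k) :
    bracket k x (bracket k y z) =
      bracket k (bracket k x y) z + bracket k y (bracket k x z) := by
  induction x using induction_basis with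
  | zero => simp
  | add x x' hx hx' =>
    simp only [map_add, LinearMap.add_apply, hx, hx']
    abel
  | smul c x hx => simp only [map_smul, LinearMap.smul_apply, hx, smul_add]
  | coe n =>
  induction y using induction_basis with
  | zero => simp
  | add x x' hx hx' =>
    simp only [map_add, LinearMap.add_apply, hx, hx']
    abel
  | smul c x hx => simp only [map_smul, LinearMap.smul_apply, hx, smul_add]
  | coe m =>
  induction z using induction_basis with
  | zero => simp
  | add x x' hx hx' =>
    simp only [map_add, hx, hx']
    abel
  | smul c x hx => simp only [map_smul, hx, smul_add]
  | coe l =>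
    simp only [bracket_e, map_smul, LinearMap.smul_apply, smul_smul]
    rw [show m + (n + l) = n + (m + l) by ring, show n + m + l = n + (m + l) by ring, ← add_smul]
    congr 1
    push_cast
    ring

/-- The Witt algebra, with Lie bracket `⁅e n, e m⁆ = (m - n) e (n + m)`. -/
instance : LieRing (Witt k) where
  bracket x y := bracket k x y
  add_lie x y z := by change bracket k (x + y) z = _; rw [map_add]; rfl
  lie_add x y z := by change bracket k x (y + z) = _; rw [map_add]
  lie_self x := bracket_self k x
  leibniz_lie x y z := bracket_leibniz k x y z

instance : LieAlgebra k (Witt k) where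
  lie_smul c x y := by change bracket k x (c • y) = _; rw [map_smul]; rfl

theorem lie_e (n m : ℤ) : ⁅e k n, e k m⁆ = ((m : k) - (n : k)) • e k (n + m) := bracket_e k n m

end

end Witt

/-- The positive Witt algebra `W₊`: the Lie subalgebra of `W` generated by the `e n`, `n ≥ 1`. -/
noncomputable abbrev WittPos (k : Type*) [Field k] : LieSubalgebra k (Witt k) :=
  LieSubalgebra.lieSpan k (Witt k) {x | ∃ n : ℤ, 1 ≤ n ∧ x = Witt.e k n}

namespace WittPos

noncomputable section

variable (k : Type*) [Field k]

/-- The elements `e n`, `n ≥ 1`, of `W₊`. -/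
def e (n : ℕ+) : WittPos k :=
  ⟨Witt.e k (n : ℤ), LieSubalgebra.subset_lieSpan ⟨(n : ℤ), by exact_mod_cast n.pos, rfl⟩⟩

/-- `W₊` is already the linear span of the `e n`, `n ≥ 1`. -/
theorem toSubmodule_eq :
    (WittPos k).toSubmodule = Submodule.span k {x | ∃ n : ℤ, 1 ≤ n ∧ x = Witt.e k n} := by
  set s : Set (Witt k) := {x | ∃ n : ℤ, 1 ≤ n ∧ x = Witt.e k n} with hs
  have hlie : ∀ x ∈ Submodule.span k s, ∀ y ∈ Submodule.span k s, ⁅x, y⁆ ∈ Submodule.span k s := by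
    intro x hx y hy
    induction hx using Submodule.span_induction with
    | zero => simp
    | add x x' _ _ h h' => rw [add_lie]; exact add_mem h h'
    | smul c x _ h => rw [smul_lie]; exact Submodule.smul_mem _ _ h
    | mem x hx =>
    induction hy using Submodule.span_induction with
    | zero => simp
    | add x x' _ _ h h' => rw [lie_add]; exact add_mem h h'
    | smul c x _ h => rw [lie_smul]; exact Submodule.smul_mem _ _ h
    | mem y hy =>
      obtain ⟨n, hn, rfl⟩ := hx
      obtain ⟨m, hm, rfl⟩ := hy
      rw [Witt.lie_e]
      exact Submodule.smul_mem _ _ (Submodule.subset_span ⟨n + m, by omega, rfl⟩)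
  apply le_antisymm
  · let K : LieSubalgebra k (Witt k) :=
      { Submodule.span k s with lie_mem' := fun {x y} hx hy => hlie x hx y hy }
    have : WittPos k ≤ K := LieSubalgebra.lieSpan_le.mpr fun x hx => Submodule.subset_span hx
    exact this
  · exact Submodule.span_le.mpr LieSubalgebra.subset_lieSpan

attribute [local instance 100] LieRing.ofAssociativeRing

variable {k} {A : Type*} [Ring A] [Algebra k A]

theorem pow_mul_comm_aux {u v : A} (h : u * v - v * u - v ^ 2 = 0) (j : ℕ) :
    v ^ j * u = u * v ^ j - (j : k) • v ^ (j + 1) := by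
  have h' : v * u = u * v - v ^ 2 := by
    rw [← sub_eq_zero, ← neg_eq_zero, ← h]; abel
  induction j with
  | zero => simp
  | succ j ih =>
    rw [pow_succ, mul_assoc, h', mul_sub, ← mul_assoc, ih, sub_mul, smul_mul_assoc, ← pow_succ,
      ← pow_add, mul_assoc, ← pow_succ]
    push_cast
    rw [add_smul, one_smul]
    abel

/-- If `u, v, w` satisfy the relations of the algebra `S`, then the elements
`(u - (n - 1) w) v ^ (n - 1)` satisfy the relations of the positive Witt algebra. -/
theorem comm_aux {u v w : A} (h₁ : u * v - v * u - v ^ 2 = 0) (h₂ : u * w - w * u - v * w = 0)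
    (h₃ : v * w - w * v = 0) (i j : ℕ) :
    (u - (i : k) • w) * v ^ i * ((u - (j : k) • w) * v ^ j)
      - (u - (j : k) • w) * v ^ j * ((u - (i : k) • w) * v ^ i)
      = ((j : k) - (i : k)) • ((u - ((i : k) + j + 1) • w) * v ^ (i + j + 1)) := by
  have hvw : Commute v w := sub_eq_zero.mp h₃
  have hwu : w * u = u * w - w * v := by
    rw [← hvw.eq, ← sub_eq_zero, ← neg_eq_zero, ← h₂]; abel
  have key : ∀ i j : ℕ, (u - (i : k) • w) * v ^ i * ((u - (j : k) • w) * v ^ j)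
      = u * u * v ^ (i + j) - (i : k) • (u * v ^ (i + j + 1)) - (j : k) • (u * w * v ^ (i + j))
        - (i : k) • (u * w * v ^ (i + j)) + (i : k) • (w * v ^ (i + j + 1))
        + ((i : k) * i) • (w * v ^ (i + j + 1)) + ((i : k) * j) • (w * w * v ^ (i + j)) := by
    intro i j
    have e₁ : v ^ i * ((u - (j : k) • w) * v ^ j)
        = u * v ^ (i + j) - (i : k) • v ^ (i + j + 1) - (j : k) • (w * v ^ (i + j)) := by
      rw [← mul_assoc, mul_sub, pow_mul_comm_aux (k := k) h₁, mul_smul_comm,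
        (hvw.pow_left i).eq, sub_mul, sub_mul, smul_mul_assoc, smul_mul_assoc, mul_assoc,
        mul_assoc, ← pow_add, ← pow_add, show i + 1 + j = i + j + 1 by ring]
    have e₂ : w * (u * v ^ (i + j)) = u * w * v ^ (i + j) - w * v ^ (i + j + 1) := by
      rw [← mul_assoc, hwu, sub_mul, mul_assoc w v, ← pow_succ']
    rw [mul_assoc, e₁, sub_mul]
    simp only [mul_sub, smul_mul_assoc, mul_smul_comm, e₂, smul_sub, smul_smul]
    simp only [← mul_assoc]
    module
  rw [key i j, key j i, add_comm j i]
  simp only [sub_mul, smul_sub, smul_mul_assoc, smul_smul]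
  module

variable (k) in
/-- For `u, v, w` in a `k`-algebra that satisfy the relations of the algebra `S`, the Lie algebra
map from `W₊` with `e n ↦ (u - (n - 1) w) v ^ (n - 1)`. It is the restriction to `W₊` of a linear
map on `W`, whose values on `e n`, `n ≤ 0`, do not matter. -/
def lieHom (u v w : A) (h₁ : u * v - v * u - v ^ 2 = 0) (h₂ : u * w - w * u - v * w = 0)
    (h₃ : v * w - w * v = 0) : WittPos k →ₗ⁅k⁆ A :=
  let F : Witt k →ₗ[k] A :=
    (Witt.basis k).constr k fun n : ℤ => (u - ((n : k) - 1) • w) * v ^ (n - 1).toNat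
  { F.comp (WittPos k).toSubmodule.subtype with
    map_lie' := by
      have hF : ∀ n : ℤ, F (Witt.e k n) = (u - ((n : k) - 1) • w) * v ^ (n - 1).toNat :=
        fun n => (Witt.basis k).constr_basis k _ n
      have key : ∀ x ∈ Submodule.span k {x | ∃ n : ℤ, 1 ≤ n ∧ x = Witt.e k n},
          ∀ y ∈ Submodule.span k {x | ∃ n : ℤ, 1 ≤ n ∧ x = Witt.e k n},
          F ⁅x, y⁆ = F x * F y - F y * F x := by
        intro x hx y hy
        induction hx using Submodule.span_induction with
        | zero => simp
        | add x x' _ _ h h' => rw [add_lie, map_add, h, h', map_add, add_mul, mul_add]; abel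
        | smul c x _ h => rw [smul_lie, map_smul, h, map_smul, smul_sub]; simp
        | mem x hx =>
        induction hy using Submodule.span_induction with
        | zero => simp
        | add x x' _ _ h h' => rw [lie_add, map_add, h, h', map_add, add_mul, mul_add]; abel
        | smul c x _ h => rw [lie_smul, map_smul, h, map_smul, smul_sub]; simp
        | mem y hy =>
          obtain ⟨n, hn, rfl⟩ := hx
          obtain ⟨m, hm, rfl⟩ := hy
          obtain ⟨i, rfl⟩ : ∃ i : ℕ, n = i + 1 := ⟨(n - 1).toNat, by omega⟩
          obtain ⟨j, rfl⟩ : ∃ j : ℕ, m = j + 1 := ⟨(m - 1).toNat, by omega⟩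
          have hc := comm_aux (k := k) h₁ h₂ h₃ i j
          rw [Witt.lie_e, map_smul, hF, hF, hF,
            show ((i : ℤ) + 1 - 1).toNat = i by omega,
            show ((j : ℤ) + 1 - 1).toNat = j by omega,
            show ((i : ℤ) + 1 + ((j : ℤ) + 1) - 1).toNat = i + j + 1 by omega]
          push_cast
          simp only [add_sub_cancel_right, add_sub_add_right_eq_sub]
          rw [hc, show (i : k) + 1 + (j + 1) - 1 = i + j + 1 by ring]
      intro x y
      exact key _ (by rw [← toSubmodule_eq]; exact x.2) _ (by rw [← toSubmodule_eq]; exact y.2) }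

theorem lieHom_e (u v w : A) (h₁ : u * v - v * u - v ^ 2 = 0) (h₂ : u * w - w * u - v * w = 0)
    (h₃ : v * w - w * v = 0) (n : ℕ+) :
    lieHom k u v w h₁ h₂ h₃ (e k n) = (u - (((n : ℕ) : k) - 1) • w) * v ^ ((n : ℕ) - 1) := by
  have : lieHom k u v w h₁ h₂ h₃ (e k n)
      = (u - ((((n : ℕ) : ℤ) : k) - 1) • w) * v ^ (((n : ℕ) : ℤ) - 1).toNat :=
    (Witt.basis k).constr_basis k _ _
  rw [this, Int.cast_natCast, show (((n : ℕ) : ℤ) - 1).toNat = (n : ℕ) - 1 by omega]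

end

end WittPos

/-! ### The algebras `R` and `S` -/

/-- The defining relation of the Jordan plane, with `u = ι 0` and `v = ι 1`. -/
inductive JordanRel (k : Type*) [Field k] : FreeAlgebra k (Fin 2) → FreeAlgebra k (Fin 2) → Prop
  | uv : JordanRel k (FreeAlgebra.ι k 0 * FreeAlgebra.ι k 1 - FreeAlgebra.ι k 1 * FreeAlgebra.ι k 0
      - FreeAlgebra.ι k 1 ^ 2) 0

/-- The Jordan plane `R = k⟨u, v⟩ / (uv - vu - v²)`. -/
def JordanPlane (k : Type*) [Field k] : Type _ := RingQuot (JordanRel k)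

noncomputable instance (k : Type*) [Field k] : Ring (JordanPlane k) :=
  inferInstanceAs (Ring (RingQuot (JordanRel k)))

noncomputable instance (k : Type*) [Field k] : Algebra k (JordanPlane k) :=
  inferInstanceAs (Algebra k (RingQuot (JordanRel k)))

/-- The defining relations of `S`, with `u = ι 0`, `v = ι 1` and `w = ι 2`. -/
inductive SRel (k : Type*) [Field k] : FreeAlgebra k (Fin 3) → FreeAlgebra k (Fin 3) → Prop
  | uv : SRel k (FreeAlgebra.ι k 0 * FreeAlgebra.ι k 1 - FreeAlgebra.ι k 1 * FreeAlgebra.ι k 0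
      - FreeAlgebra.ι k 1 ^ 2) 0
  | uw : SRel k (FreeAlgebra.ι k 0 * FreeAlgebra.ι k 2 - FreeAlgebra.ι k 2 * FreeAlgebra.ι k 0
      - FreeAlgebra.ι k 1 * FreeAlgebra.ι k 2) 0
  | vw : SRel k (FreeAlgebra.ι k 1 * FreeAlgebra.ι k 2 - FreeAlgebra.ι k 2 * FreeAlgebra.ι k 1) 0

/-- The algebra `S = k⟨u, v, w⟩ / (uv - vu - v², uw - wu - vw, vw - wv)`. -/
def SAlg (k : Type*) [Field k] : Type _ := RingQuot (SRel k)

noncomputable instance (k : Type*) [Field k] : Ring (SAlg k) :=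
  inferInstanceAs (Ring (RingQuot (SRel k)))

noncomputable instance (k : Type*) [Field k] : Algebra k (SAlg k) :=
  inferInstanceAs (Algebra k (RingQuot (SRel k)))

namespace JordanPlane

noncomputable section

variable (k : Type*) [Field k]

/-- The quotient map from the free algebra. -/
def mk : FreeAlgebra k (Fin 2) →ₐ[k] JordanPlane k := RingQuot.mkAlgHom k (JordanRel k)

theorem mk_rel {x : FreeAlgebra k (Fin 2)} (h : JordanRel k x 0) : mk k x = 0 :=
  (RingQuot.mkAlgHom_rel k h).trans (map_zero (mk k))

/-- The generator `u` of the Jordan plane. -/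
def u : JordanPlane k := mk k (FreeAlgebra.ι k 0)

/-- The generator `v` of the Jordan plane. -/
def v : JordanPlane k := mk k (FreeAlgebra.ι k 1)

theorem rel_uv : u k * v k - v k * u k - v k ^ 2 = 0 := by
  simpa [u, v] using mk_rel k JordanRel.uv

/-- The component `R_n` of the grading of `R` with `deg u = deg v = 1`: the span of the products
of `n` generators. -/
def gradedPart (n : ℕ) : Submodule k (JordanPlane k) := Submodule.span k {u k, v k} ^ n

/-- `R_{≥ n}`, the sum of the `R_m` with `m ≥ n`. -/
def gradedPartGE (n : ℕ) : Submodule k (JordanPlane k) := ⨆ m ≥ n, gradedPart k m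

end

end JordanPlane

namespace SAlg

noncomputable section

variable (k : Type*) [Field k]

/-- The quotient map from the free algebra. -/
def mk : FreeAlgebra k (Fin 3) →ₐ[k] SAlg k := RingQuot.mkAlgHom k (SRel k)

theorem mk_rel {x : FreeAlgebra k (Fin 3)} (h : SRel k x 0) : mk k x = 0 :=
  (RingQuot.mkAlgHom_rel k h).trans (map_zero (mk k))

/-- The generator `u` of `S`. -/
def u : SAlg k := mk k (FreeAlgebra.ι k 0)

/-- The generator `v` of `S`. -/
def v : SAlg k := mk k (FreeAlgebra.ι k 1)

/-- The generator `w` of `S`. -/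
def w : SAlg k := mk k (FreeAlgebra.ι k 2)

theorem rel_uv : u k * v k - v k * u k - v k ^ 2 = 0 := by
  simpa [u, v] using mk_rel k SRel.uv

theorem rel_uw : u k * w k - w k * u k - v k * w k = 0 := by
  simpa [u, v, w] using mk_rel k SRel.uw

theorem rel_vw : v k * w k - w k * v k = 0 := by
  simpa [v, w] using mk_rel k SRel.vw

end

end SAlg

/-! ### The enveloping algebra `U(W₊)` and the maps `φ` and `λ_a` -/

/-- The universal enveloping algebra `U(W₊)`. -/
abbrev UWittPos (k : Type*) [Field k] : Type _ := UniversalEnvelopingAlgebra k (WittPos k)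

namespace UWittPos

noncomputable section

variable (k : Type*) [Field k]

/-- The generators `e n`, `n ≥ 1`, of `U(W₊)`. -/
def e (n : ℕ+) : UWittPos k := UniversalEnvelopingAlgebra.ι k (WittPos.e k n)

/-- The component `U(W₊)_d` of the grading of `U(W₊)` with `deg (e n) = n`: the span of the
products `e i₁ ⋯ e iᵣ` with `i₁ + ⋯ + iᵣ = d`. -/
def gradedPart (d : ℕ) : Submodule k (UWittPos k) :=
  Submodule.span k {x | ∃ l : List ℕ+, (l.map fun n => (n : ℕ)).sum = d ∧ x = (l.map (e k)).prod}

/-- The algebra map `φ : U(W₊) → S` with `φ (e n) = (u - (n - 1) w) v ^ (n - 1)`. -/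
def phi : UWittPos k →ₐ[k] SAlg k :=
  UniversalEnvelopingAlgebra.lift k
    (WittPos.lieHom k (SAlg.u k) (SAlg.v k) (SAlg.w k)
      (SAlg.rel_uv k) (SAlg.rel_uw k) (SAlg.rel_vw k))

theorem phi_e (n : ℕ+) :
    phi k (e k n) = (SAlg.u k - (((n : ℕ) : k) - 1) • SAlg.w k) * SAlg.v k ^ ((n : ℕ) - 1) := by
  rw [phi, e, UniversalEnvelopingAlgebra.lift_ι_apply, WittPos.lieHom_e]

variable {k}

/-- The algebra map `λ_a : U(W₊) → R` with `λ_a (e n) = (u - (n - 1) a v) v ^ (n - 1)`. -/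
def lam (a : k) : UWittPos k →ₐ[k] JordanPlane k :=
  UniversalEnvelopingAlgebra.lift k
    (WittPos.lieHom k (JordanPlane.u k) (JordanPlane.v k) (a • JordanPlane.v k)
      (JordanPlane.rel_uv k)
      (by
        rw [mul_smul_comm, smul_mul_assoc, mul_smul_comm, ← smul_sub, ← smul_sub, ← sq,
          JordanPlane.rel_uv, smul_zero])
      (by rw [mul_smul_comm, smul_mul_assoc, sub_self]))

theorem lam_e (a : k) (n : ℕ+) :
    lam a (e k n) = (JordanPlane.u k - ((((n : ℕ) : k) - 1) * a) • JordanPlane.v k)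
      * JordanPlane.v k ^ ((n : ℕ) - 1) := by
  rw [lam, e, UniversalEnvelopingAlgebra.lift_ι_apply, WittPos.lieHom_e, smul_smul]

/-- `h₁ = e₁e₂² - e₁²e₃ - 2a e₂e₃ + (1 + 2a) e₁e₄ - (a² + a) e₅`. -/
def h₁ (a : k) : UWittPos k :=
  e k 1 * e k 2 ^ 2 - e k 1 ^ 2 * e k 3 - (2 * a) • (e k 2 * e k 3)
    + (1 + 2 * a) • (e k 1 * e k 4) - (a ^ 2 + a) • e k 5

variable (k) in
/-- `h₂ = e₁e₅ - 4 e₂e₄ + 3 e₃² + 2 e₆`. -/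
def h₂ : UWittPos k :=
  e k 1 * e k 5 - 4 * (e k 2 * e k 4) + 3 * e k 3 ^ 2 + 2 * e k 6

/-- `h₃ = -4 e₁²e₂² - 4 e₂³ + 4 e₁³e₃ + (20a² + 14a - 7) e₃² - (16a² + 18a + 5) e₁e₅
+ (16a³ + 36a² + 16a - 2) e₆`. -/
def h₃ (a : k) : UWittPos k :=
  -(4 * (e k 1 ^ 2 * e k 2 ^ 2)) - 4 * e k 2 ^ 3 + 4 * (e k 1 ^ 3 * e k 3)
    + (20 * a ^ 2 + 14 * a - 7) • e k 3 ^ 2 - (16 * a ^ 2 + 18 * a + 5) • (e k 1 * e k 5)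
    + (16 * a ^ 3 + 36 * a ^ 2 + 16 * a - 2) • e k 6

end

end UWittPos

/-!
Write `E i = e (i + 1)`. Both `φ` and `λ_a` send `E i` to `(u - i w) vⁱ` for a triple `u`, `v`, `w`
satisfying the relations of `S`, with `w = a v` in the case of `λ_a`, and for these images the
defect `E i E j - E 0 E (i + j) + i E (i + j + 1)` is `ij` times an element depending only on
`i + j`. In degree `6` this proportionality is the sextic relation `h₂ = 0`, and commutators with
the generators propagate it to all degrees. It reduces every product to explicit normal forms, fewer
of them when further relations hold, and the images of the normal forms have distinct leading
monomials in `S` or `R`; this determines the kernels.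

The image of `λ_a` contains a left ideal `T` of `R` (`R_{≥ 4}` if `a ≠ 0, 1`, and `Ru` if `a = 1`)
such that for every left ideal `J ⊇ T` only a finite-dimensional part of `R / J` is killed by `T`,
so left noetherianity descends from `R`. It passes from `a = 1` to `a = 0` because the kernels
agree, and from left to right by the anti-automorphism `u ↦ -u`, `v ↦ v`, which exchanges `λ_a`
and `λ_{1 - a}`.
-/

/-! ### Kernels, generators and leading terms -/

section LinearAlgebra

theorem ker_le_ker_of_linearIndependent {k A B C ι : Type*} [Ring k] [AddCommGroup A]
    [AddCommGroup B] [AddCommGroup C] [Module k A] [Module k B] [Module k C]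
    {f : A →ₗ[k] B} {π : A →ₗ[k] C} {nf : ι → A} (hπ : LinearMap.ker π ≤ LinearMap.ker f)
    (hli : LinearIndependent k (f ∘ nf))
    (hspan : ∀ x, π x ∈ Submodule.span k (Set.range (π ∘ nf))) :
    LinearMap.ker f ≤ LinearMap.ker π := by
  intro x hx
  obtain ⟨c, hc⟩ := (Finsupp.mem_span_range_iff_exists_finsupp).mp (hspan x)
  have hy : x - Finsupp.linearCombination k nf c ∈ LinearMap.ker π := by
    rw [LinearMap.mem_ker, map_sub, Finsupp.apply_linearCombination, ← hc]
    exact sub_self _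
  have hfy : Finsupp.linearCombination k (f ∘ nf) c = 0 := by
    have := LinearMap.mem_ker.mp (hπ hy)
    rwa [map_sub, LinearMap.mem_ker.mp hx, zero_sub, neg_eq_zero,
      Finsupp.apply_linearCombination] at this
  rwa [linearIndependent_iff.mp hli c hfy, map_zero, sub_zero] at hy

variable {k A B : Type*} [CommRing k] [Ring A] [Algebra k A] [Ring B] [Algebra k B]

theorem ker_eq_span_of_linearIndependent {ι : Type*} {f : A →ₐ[k] B} {s : Set A}
    (hs : ∀ x ∈ s, f x = 0) {nf : ι → A} (hli : LinearIndependent k (f ∘ nf))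
    (hspan : ∀ x, (TwoSidedIdeal.span s).ringCon.mkₐ k x ∈
      Submodule.span k (Set.range ((TwoSidedIdeal.span s).ringCon.mkₐ k ∘ nf))) :
    TwoSidedIdeal.ker f = TwoSidedIdeal.span s := by
  set π := (TwoSidedIdeal.span s).ringCon.mkₐ k
  have hπ : ∀ x, π x = 0 ↔ x ∈ TwoSidedIdeal.span s := fun x => RingCon.eq _
  have hle : TwoSidedIdeal.span s ≤ TwoSidedIdeal.ker f :=
    TwoSidedIdeal.span_le.mpr fun x hx => (TwoSidedIdeal.mem_ker f).mpr (hs x hx)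
  have hker : LinearMap.ker f.toLinearMap ≤ LinearMap.ker π.toLinearMap :=
    ker_le_ker_of_linearIndependent
      (fun x hx => (TwoSidedIdeal.mem_ker f).mp (hle ((hπ x).mp hx))) hli hspan
  exact le_antisymm (fun x hx => (hπ x).mp (hker ((TwoSidedIdeal.mem_ker f).mp hx))) hle

theorem mul_mem_of_mem_adjoin {s : Set A} {N : Submodule k A} (hN : ∀ x ∈ s, ∀ y ∈ N, x * y ∈ N)
    {x y : A} (hx : x ∈ Algebra.adjoin k s) (hy : y ∈ N) : x * y ∈ N := by
  induction hx using Algebra.adjoin_induction generalizing y with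
  | mem x hx => exact hN x hx y hy
  | algebraMap c => rw [← Algebra.smul_def]; exact N.smul_mem c hy
  | add x z _ _ hx hz => rw [add_mul]; exact add_mem (hx hy) (hz hy)
  | mul x z _ _ hx hz => rw [mul_assoc]; exact hx (hz hy)

theorem mem_of_mem_adjoin {s : Set A} {N : Submodule k A} (h1 : 1 ∈ N)
    (hN : ∀ x ∈ s, ∀ y ∈ N, x * y ∈ N) {x : A} (hx : x ∈ Algebra.adjoin k s) : x ∈ N := by
  simpa using mul_mem_of_mem_adjoin hN hx h1

theorem mul_mem_of_mem_adjoin_right {s : Set A} {N : Submodule k A}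
    (hN : ∀ x ∈ s, ∀ y ∈ N, y * x ∈ N) {x y : A} (hx : x ∈ Algebra.adjoin k s) (hy : y ∈ N) :
    y * x ∈ N := by
  induction hx using Algebra.adjoin_induction generalizing y with
  | mem x hx => exact hN x hx y hy
  | algebraMap c => rw [← Algebra.commutes, ← Algebra.smul_def]; exact N.smul_mem c hy
  | add x z _ _ hx hz => rw [mul_add]; exact add_mem (hx hy) (hz hy)
  | mul x z _ _ hx hz => rw [← mul_assoc]; exact hz (hx hy)

theorem mem_of_mem_adjoin_right {s : Set A} {N : Submodule k A} (h1 : 1 ∈ N)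
    (hN : ∀ x ∈ s, ∀ y ∈ N, y * x ∈ N) {x : A} (hx : x ∈ Algebra.adjoin k s) : x ∈ N := by
  simpa using mul_mem_of_mem_adjoin_right hN hx h1

theorem mul_mem_span_range {ι : Type*} {f : ι → A} {x : A} {N : Submodule k A}
    (hN : ∀ i, x * f i ∈ N) {y : A} (hy : y ∈ Submodule.span k (Set.range f)) : x * y ∈ N := by
  refine (Submodule.map_span_le (LinearMap.mulLeft k x) _ N).mpr ?_ (Submodule.mem_map_of_mem hy)
  rintro _ ⟨i, rfl⟩
  exact hN i

theorem mul_mem_span_range_right {ι : Type*} {f : ι → A} {x : A} {N : Submodule k A}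
    (hN : ∀ i, f i * x ∈ N) {y : A} (hy : y ∈ Submodule.span k (Set.range f)) : y * x ∈ N := by
  refine (Submodule.map_span_le (LinearMap.mulRight k x) _ N).mpr ?_ (Submodule.mem_map_of_mem hy)
  rintro _ ⟨i, rfl⟩
  exact hN i

end LinearAlgebra

section Leading

variable {k V M W : Type*} [Field k] [AddCommGroup V] [Module k V] [LinearOrder W]
  {b : Module.Basis M k V} {wt : M → W}

/-- The basis vector `b μ` is the leading term of `x` for the weight `wt`: it occurs in `x`, and
the other basis vectors that occur in `x` have smaller weight. -/
def HasLeading (b : Module.Basis M k V) (wt : M → W) (μ : M) (x : V) : Prop :=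
  b.repr x μ ≠ 0 ∧ ∀ ν, ν ≠ μ → b.repr x ν ≠ 0 → wt ν < wt μ

theorem hasLeading_basis (μ : M) : HasLeading b wt μ (b μ) := by
  refine ⟨by simp, fun ν hν h => absurd ?_ h⟩
  rw [b.repr_self, Finsupp.single_eq_of_ne hν]

theorem exists_hasLeading (hwt : Function.Injective wt) {x : V} (hx : x ≠ 0) :
    ∃ μ, HasLeading b wt μ x := by
  obtain ⟨μ, hμ, hmax⟩ := Finset.exists_max_image (b.repr x).support wt
    (Finsupp.support_nonempty_iff.mpr (by simpa using hx))
  exact ⟨μ, Finsupp.mem_support_iff.mp hμ, fun ν hν h =>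
    (hmax ν (Finsupp.mem_support_iff.mpr h)).lt_of_ne (hwt.ne hν)⟩

theorem linearIndependent_of_hasLeading {ι : Type*} {σ : ι → M} (hσ : Function.Injective σ)
    {f : ι → V} (hf : ∀ i, HasLeading b wt (σ i) (f i)) : LinearIndependent k f := by
  rw [linearIndependent_iff]
  intro l hl
  by_contra hne
  obtain ⟨i, hi, hmax⟩ := Finset.exists_max_image l.support (fun i => wt (σ i))
    (Finsupp.support_nonempty_iff.mpr hne)
  have hcoord : b.repr (Finsupp.linearCombination k f l) (σ i) = l i * b.repr (f i) (σ i) := by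
    rw [Finsupp.linearCombination_apply, Finsupp.sum, map_sum, Finsupp.finsetSum_apply,
      Finset.sum_eq_single i _ fun h => absurd hi h, map_smul, Finsupp.smul_apply, smul_eq_mul]
    intro j hj hji
    by_contra h
    rw [map_smul, Finsupp.smul_apply, smul_eq_mul] at h
    exact ((hf j).2 _ (hσ.ne hji.symm) (right_ne_zero_of_mul h)).not_ge (hmax j hj)
  rw [hl, map_zero, Finsupp.zero_apply] at hcoord
  exact mul_ne_zero (Finsupp.mem_support_iff.mp hi) (hf i).1 hcoord.symm

namespace HasLeading

theorem smul {μ : M} {x : V} (hx : HasLeading b wt μ x) {c : k} (hc : c ≠ 0) :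
    HasLeading b wt μ (c • x) := by
  simpa [HasLeading, hc] using hx

theorem add_smul {μ ν : M} {x y : V} (hx : HasLeading b wt μ x) (hy : HasLeading b wt ν y)
    (hνμ : wt ν < wt μ) (c : k) : HasLeading b wt μ (x + c • y) := by
  have hy' : ∀ ξ, b.repr y ξ ≠ 0 → wt ξ < wt μ := fun ξ h => by
    by_cases hξ : ξ = ν
    · exact hξ ▸ hνμ
    · exact (hy.2 ξ hξ h).trans hνμ
  have hyμ : b.repr y μ = 0 := not_not.mp fun h => lt_irrefl _ (hy' μ h)
  refine ⟨by simpa [hyμ] using hx.1, fun ξ hξ h => ?_⟩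
  by_contra hlt
  exact h (by simp [not_imp_comm.mp (hx.2 ξ hξ) hlt, not_imp_comm.mp (hy' ξ) hlt])

theorem exists_sub_smul {μ : M} {x y : V} (hwt : Function.Injective wt)
    (hx : HasLeading b wt μ x) (hy : HasLeading b wt μ y) :
    ∃ c : k, x - c • y = 0 ∨ ∃ ν, wt ν < wt μ ∧ HasLeading b wt ν (x - c • y) := by
  refine ⟨b.repr x μ / b.repr y μ, or_iff_not_imp_left.mpr fun h0 => ?_⟩
  obtain ⟨ν, hν⟩ := exists_hasLeading (b := b) hwt h0
  refine ⟨ν, ?_, hν⟩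
  by_contra hlt
  apply hν.1
  by_cases hνμ : ν = μ
  · simp [hνμ, div_mul_cancel₀ _ hy.1]
  · simp [not_imp_comm.mp (hx.2 ν hνμ) hlt, not_imp_comm.mp (hy.2 ν hνμ) hlt]

variable {τ : M → M} {T : Module.End k V}

theorem map (hτ : ∀ ν μ, wt ν < wt μ → wt (τ ν) < wt (τ μ))
    (hT : ∀ μ, HasLeading b wt (τ μ) (T (b μ))) {μ : M} {x : V} (hx : HasLeading b wt μ x) :
    HasLeading b wt (τ μ) (T x) := by
  have hrepr : ∀ ξ, b.repr (T x) ξ = ∑ ν ∈ (b.repr x).support, b.repr x ν * b.repr (T (b ν)) ξ := by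
    intro ξ
    conv_lhs => rw [← b.linearCombination_repr x, Finsupp.linearCombination_apply, Finsupp.sum]
    simp only [map_sum, map_smul, Finsupp.finsetSum_apply, Finsupp.smul_apply, smul_eq_mul]
  constructor
  · rw [hrepr, Finset.sum_eq_single μ]
    · exact mul_ne_zero hx.1 (hT μ).1
    · intro ν hν hνμ
      have hlt := hτ ν μ (hx.2 ν hνμ (Finsupp.mem_support_iff.mp hν))
      by_contra h
      exact ((hT ν).2 _ (fun he => hlt.ne (he ▸ rfl)) (right_ne_zero_of_mul h)).not_gt hlt
    · exact fun h => absurd (Finsupp.mem_support_iff.mpr hx.1) h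
  · intro ξ hξ h
    rw [hrepr] at h
    obtain ⟨ν, hν, hνξ⟩ := Finset.exists_ne_zero_of_sum_ne_zero h
    by_cases hνμ : ν = μ
    · exact (hT μ).2 ξ hξ (hνμ ▸ right_ne_zero_of_mul hνξ)
    have hlt := hτ ν μ (hx.2 ν hνμ (Finsupp.mem_support_iff.mp hν))
    by_cases hξν : ξ = τ ν
    · exact hξν ▸ hlt
    · exact ((hT ν).2 ξ hξν (right_ne_zero_of_mul hνξ)).trans hlt

theorem pow_mul {A M : Type*} [Ring A] [Algebra k A] [AddMonoid M] {b : Module.Basis M k A}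
    {wt : M → W} {δ : M} {y : A} (hδ : ∀ ν μ, wt ν < wt μ → wt (ν + δ) < wt (μ + δ))
    (hy : ∀ μ, HasLeading b wt (μ + δ) (y * b μ)) {μ : M} {x : A} (hx : HasLeading b wt μ x)
    (n : ℕ) : HasLeading b wt (μ + n • δ) (y ^ n * x) := by
  induction n with
  | zero => simpa using hx
  | succ n ih =>
    rw [succ_nsmul, ← add_assoc, pow_succ', mul_assoc]
    exact ih.map (T := LinearMap.mulLeft k y) hδ hy

end HasLeading

/-- A noncommutative form of the Hilbert basis theorem: the leading terms of a left ideal form an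
up-set for the well-quasi-order `≤`, and lifts of its finitely many minimal elements generate. -/
theorem isNoetherianRing_of_hasLeading {k A M W : Type*} [Field k] [Ring A] [Algebra k A]
    [PartialOrder M] [WellQuasiOrderedLE M] [LinearOrder W] [WellFoundedLT W]
    {b : Module.Basis M k A} {wt : M → W} (hwt : Function.Injective wt)
    (hmul : ∀ μ ν, μ ≤ ν → ∃ r : A, ∀ x, HasLeading b wt μ x → HasLeading b wt ν (r * x)) :
    IsNoetherianRing A := by
  refine (isNoetherianRing_iff_ideal_fg _).mpr fun I => ?_
  let L : Set M := {μ | ∃ x ∈ I, HasLeading b wt μ x}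
  have hfin : {μ | Minimal (· ∈ L) μ}.Finite :=
    WellQuasiOrderedLE.finite_of_isAntichain (setOfPred_minimal_antichain _)
  choose! g hgI hg using fun μ (hμ : μ ∈ L) => hμ
  set J := Ideal.span (g '' {μ | Minimal (· ∈ L) μ})
  have hJI : J ≤ I := Ideal.span_le.mpr (by rintro _ ⟨μ, hμ, rfl⟩; exact hgI μ hμ.prop)
  have key : ∀ w : W, ∀ ν, wt ν = w → ∀ x ∈ I, HasLeading b wt ν x → x ∈ J := by
    intro w
    induction w using WellFoundedLT.induction with
    | _ w ih =>
    rintro ν rfl x hx hν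
    obtain ⟨μ, hμν, hμ⟩ := exists_minimal_le_of_wellFoundedLT (· ∈ L) ν ⟨x, hx, hν⟩
    obtain ⟨r, hr⟩ := hmul μ ν hμν
    have hy : r * g μ ∈ J := J.mul_mem_left r (Ideal.subset_span ⟨μ, hμ, rfl⟩)
    obtain ⟨c, hc⟩ := hν.exists_sub_smul hwt (hr _ (hg μ hμ.prop))
    have hcy : c • (r * g μ) ∈ J := J.smul_of_tower_mem c hy
    rw [← J.sub_mem_iff_left hcy]
    rcases hc with h0 | ⟨ξ, hξ, hlead⟩
    · rw [h0]; exact zero_mem J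
    · exact ih _ hξ ξ rfl _ (sub_mem hx (hJI hcy)) hlead
  refine ⟨(hfin.image g).toFinset, ?_⟩
  rw [Set.Finite.coe_toFinset]
  refine le_antisymm hJI fun x hx => ?_
  by_cases h0 : x = 0
  · rw [h0]; exact zero_mem J
  · obtain ⟨ν, hν⟩ := exists_hasLeading (b := b) hwt h0
    exact key _ ν rfl x hx hν

end Leading

/-! ### Families satisfying the relations of the positive Witt algebra -/

section WittFamily

/-- A family `E i`, thought of as `e (i + 1)`, that satisfies the relations of `W₊`. -/
def IsWittFamily (k : Type*) [Field k] {A : Type*} [Ring A] [Algebra k A] (E : ℕ → A) : Prop :=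
  ∀ i j : ℕ, E i * E j - E j * E i = ((j : k) - i) • E (i + j + 1)

variable (k : Type*) [Field k] {A : Type*} [Ring A] [Algebra k A]

/-- The failure of the product of two members of a Witt family to be equal to
`E 0 * E (i + j) - i • E (i + j + 1)`, which is its value for the family `u * v ^ i` in the Jordan
plane. -/
def defect (E : ℕ → A) (i j : ℕ) : A :=
  E i * E j - E 0 * E (i + j) + (i : k) • E (i + j + 1)

/-- The element `Z t` of degree `t + 4` such that `defect k E i j = (i * j) • Z t` for all `i`, `j`
of sum `t + 2` as soon as the defects of that degree are proportional to `i * j`. -/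
def unitDefect (E : ℕ → A) (t : ℕ) : A :=
  ((t : k) + 1)⁻¹ • defect k E 1 (t + 1)

/-- The element `e₁e₃ - e₂² - e₄`. -/
def quartic (E : ℕ → A) : A := E 0 * E 2 - E 1 ^ 2 - E 3

/-- The element `e₁e₅ - 4 e₂e₄ + 3 e₃² + 2 e₆`. -/
def sextic (E : ℕ → A) : A := E 0 * E 4 - 4 * (E 1 * E 3) + 3 * E 2 ^ 2 + 2 * E 5

variable {k} in
/-- The element of degree `n + t + 5` whose vanishing expresses `e (n + 1) * Z t` through elements
of smaller length in the way that is forced by `λ_a`. -/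
def cubicRel (E : ℕ → A) (a : k) (n t : ℕ) : A :=
  E n * unitDefect k E t - (a ^ 2 - a) • E (n + t + 4)
    - (((t : k) + 4) * a) • unitDefect k E (n + t + 1)

theorem ofNat_mul_eq_smul (n : ℕ) [n.AtLeastTwo] (x : A) :
    (OfNat.ofNat n : A) * x = (OfNat.ofNat n : k) • x := by
  rw [Algebra.smul_def, map_ofNat]

@[simp]
theorem defect_zero_left (E : ℕ → A) (j : ℕ) : defect k E 0 j = 0 := by
  simp [defect]

section map

variable {k} {B : Type*} [Ring B] [Algebra k B] (f : A →ₐ[k] B) (E : ℕ → A)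

theorem map_defect (i j : ℕ) : f (defect k E i j) = defect k (f ∘ E) i j := by
  simp [defect]

theorem map_unitDefect (t : ℕ) : f (unitDefect k E t) = unitDefect k (f ∘ E) t := by
  simp [unitDefect, map_defect]

theorem map_quartic : f (quartic E) = quartic (f ∘ E) := by
  simp [quartic]

theorem map_sextic : f (sextic E) = sextic (f ∘ E) := by
  simp [sextic, map_ofNat]

theorem map_cubicRel (a : k) (n t : ℕ) : f (cubicRel E a n t) = cubicRel (f ∘ E) a n t := by
  simp [cubicRel, map_unitDefect]

end map

theorem quartic_eq_defect (E : ℕ → A) : quartic E = -defect k E 1 1 := by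
  rw [quartic, defect, sq, Nat.cast_one, one_smul]
  abel

theorem sextic_eq_defect (E : ℕ → A) :
    sextic E = (3 : k) • defect k E 2 2 - (4 : k) • defect k E 1 3 := by
  simp only [sextic, defect, sq, ofNat_mul_eq_smul k]
  push_cast
  module

namespace IsWittFamily

variable {k} {E : ℕ → A}

theorem comp {B : Type*} [Ring B] [Algebra k B] (hE : IsWittFamily k E) (f : A →ₐ[k] B) :
    IsWittFamily k (f ∘ E) := fun i j => by
  simp only [Function.comp_apply, ← map_mul, ← map_sub, hE i j, map_smul]

theorem defect_comm (hE : IsWittFamily k E) (i j : ℕ) : defect k E i j = defect k E j i := by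
  have h := hE i j
  rw [defect, defect, add_comm j i]
  linear_combination (norm := module) h

theorem comm_defect (hE : IsWittFamily k E) (m i j : ℕ) :
    E m * defect k E i j - defect k E i j * E m
      = ((i : k) - m) • defect k E (m + i + 1) j + ((j : k) - m) • defect k E i (m + j + 1)
        + (m : k) • defect k E (m + 1) (i + j) := by
  have hij := congrArg₂ (· + ·) (congrArg (· * E j) (hE m i)) (congrArg (E i * ·) (hE m j))
  have h0 := congrArg₂ (· + ·) (congrArg (· * E (i + j)) (hE m 0))
    (congrArg (E 0 * ·) (hE m (i + j)))
  have h1 := hE m (i + j + 1)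
  simp only [defect, mul_add, mul_sub, add_mul, sub_mul, mul_smul_comm, smul_mul_assoc, mul_assoc]
    at hij h0 h1 ⊢
  rw [show m + i + 1 + j = m + (i + j) + 1 by ring, show i + (m + j + 1) = m + (i + j) + 1 by ring,
    show m + 1 + (i + j) = m + (i + j) + 1 by ring]
  rw [add_zero] at h0
  push_cast at h0 h1 ⊢
  linear_combination (norm := module) hij - h0 + (i : k) • h1

theorem comm_eq_of_defect_eq (hE : IsWittFamily k E) {s : ℕ} {z : A}
    (h : ∀ i j, i + j = s → defect k E i j = ((i : k) * j) • z) (m : ℕ) {i j : ℕ}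
    (hij : i + j = s) :
    ((i : k) - m) • defect k E (m + i + 1) j + ((j : k) - m) • defect k E i (m + j + 1)
        + (m : k) • defect k E (m + 1) s = ((i : k) * j) • (E m * z - z * E m) := by
  rw [← hij, ← hE.comm_defect, h i j hij, mul_smul_comm, smul_mul_assoc, smul_sub]

theorem mul_zero_eq (hE : IsWittFamily k E) (i : ℕ) :
    E (i + 1) * E 0 = E 0 * E (i + 1) - ((i : k) + 1) • E (i + 2) := by
  have h := hE (i + 1) 0
  push_cast at h
  linear_combination (norm := module) h

end IsWittFamily

variable [CharZero k]

theorem smul_unitDefect (E : ℕ → A) (t : ℕ) :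
    ((t : k) + 1) • unitDefect k E t = defect k E 1 (t + 1) :=
  smul_inv_smul₀ (Nat.cast_add_one_ne_zero t) _

theorem smul_unitDefect_eq (E : ℕ → A) (t : ℕ) :
    ((t : k) + 1) • unitDefect k E t = E 1 * E (t + 1) - E 0 * E (t + 2) + E (t + 3) := by
  rw [smul_unitDefect, defect, add_comm 1 (t + 1), Nat.cast_one, one_smul]

theorem natCast_add_four_ne_zero (t : ℕ) : (t : k) + 4 ≠ 0 := by
  exact_mod_cast Nat.succ_ne_zero (t + 3)

namespace IsWittFamily

variable {k} {E : ℕ → A}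

theorem smul_defect_two (hE : IsWittFamily k E) {r : ℕ} {y z : A}
    (hy : ∀ i j, i + j = r + 4 → defect k E i j = ((i : k) * j) • y)
    (hz : ∀ i j, i + j = r + 3 → defect k E i j = ((i : k) * j) • z) :
    ((r : k) + 4) • defect k E 2 (r + 3) = (2 * ((r : k) + 3)) • defect k E 1 (r + 4) := by
  have e₁ := hE.comm_eq_of_defect_eq hy 0 (i := 1) (j := r + 3) (by ring)
  have e₂ := hE.comm_eq_of_defect_eq hy 0 (i := 2) (j := r + 2) (by ring)
  have e₃ := hE.comm_eq_of_defect_eq hy 0 (i := 3) (j := r + 1) (by ring)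
  have f₁ := hE.comm_eq_of_defect_eq hz 1 (i := 1) (j := r + 2) (by ring)
  have f₂ := hE.comm_eq_of_defect_eq hz 1 (i := 2) (j := r + 1) (by ring)
  simp only [zero_add, Nat.reduceAdd, add_assoc, add_comm 1, Nat.cast_zero, zero_smul] at e₁ e₂ e₃
  simp only [Nat.reduceAdd, add_assoc, add_comm 1] at f₁ f₂
  push_cast at e₁ e₂ e₃ f₁ f₂
  have hne : ((r : k) + 1) * (r ^ 2 + 7 * r + 4) ≠ 0 := by
    exact_mod_cast (by positivity : (r + 1) * (r ^ 2 + 7 * r + 4) ≠ 0)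
  rw [← sub_eq_zero, ← smul_eq_zero_iff_right hne]
  linear_combination (norm := module) (6 * ((r : k) + 3) * (r + 2)) • f₂
    - (2 * ((r : k) + 3) * (r + 2)) • e₃ + (((r : k) + 3) * (r + 2) * (r + 1)) • e₂
    - (12 * ((r : k) + 3) * (r + 1)) • f₁ + (2 * ((r : k) + 2) * (r + 1) * (1 - r)) • e₁

theorem defect_eq_of_defect_one_two (hE : IsWittFamily k E) {s : ℕ} {y z : A}
    (hy : ∀ i j, i + j = s + 1 → defect k E i j = ((i : k) * j) • y)
    (h₁ : defect k E 1 (s + 1) = ((s : k) + 1) • z) (h₂ : defect k E 2 s = (2 * (s : k)) • z)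
    (hs : s ≠ 0) {i j : ℕ} (hij : i + j = s + 2) :
    defect k E i j = ((i : k) * j) • z := by
  have hrec : ∀ i j, i + j = s + 1 →
      (i : k) • defect k E (i + 1) j + (j : k) • defect k E i (j + 1)
        = ((i : k) * j) • (E 0 * y - y * E 0) := fun i j hij => by
    simpa using hE.comm_eq_of_defect_eq hy 0 hij
  have hY : E 0 * y - y * E 0 = ((s : k) + 3) • z := by
    have h := hrec 1 s (by ring)
    rw [h₁, h₂] at h
    rw [← sub_eq_zero, ← smul_eq_zero_iff_right (Nat.cast_ne_zero.mpr hs : (s : k) ≠ 0)]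
    linear_combination (norm := (push_cast; module)) -h
  induction i generalizing j with
  | zero => simp
  | succ i ih =>
    rcases i with _ | i
    · obtain rfl : j = s + 1 := by omega
      simpa using h₁
    have hi := ih (j := j + 1) (by omega)
    have h := hrec (i + 1) j (by omega)
    obtain rfl : s = i + j := by omega
    rw [hY, hi] at h
    rw [← sub_eq_zero, ← smul_eq_zero_iff_right (Nat.cast_add_one_ne_zero i : (i : k) + 1 ≠ 0)]
    linear_combination (norm := (push_cast; module)) h

theorem defect_eq (hE : IsWittFamily k E) (h : sextic E = 0) (t : ℕ) {i j : ℕ}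
    (hij : i + j = t + 2) : defect k E i j = ((i : k) * j) • unitDefect k E t := by
  induction t using Nat.strong_induction_on generalizing i j with
  | _ t ih =>
  have h₁ := smul_unitDefect k E t
  have step : ∀ s, t = s + 1 → defect k E 2 (s + 1) = (2 * ((s : k) + 1)) • unitDefect k E t →
      defect k E i j = ((i : k) * j) • unitDefect k E t := by
    rintro s rfl h₂
    exact hE.defect_eq_of_defect_one_two (fun i j hij => ih s (by omega) hij)
      (by exact_mod_cast h₁.symm) (by exact_mod_cast h₂) s.succ_ne_zero hij
  match t with
  | 0 =>
    rw [Nat.cast_zero, zero_add, one_smul] at h₁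
    obtain ⟨rfl, rfl⟩ | ⟨rfl, rfl⟩ | ⟨rfl, rfl⟩ :
        (i = 0 ∧ j = 2) ∨ (i = 1 ∧ j = 1) ∨ (i = 2 ∧ j = 0) := by omega
    · simp
    · simp [h₁]
    · simp [hE.defect_comm 2 0]
  | 1 =>
    refine step 0 rfl ?_
    rw [hE.defect_comm, ← h₁]
    norm_num
  | 2 =>
    refine step 1 rfl ?_
    have h₃ : (3 : k) • defect k E 2 2 = (4 : k) • defect k E 1 3 :=
      sub_eq_zero.mp ((sextic_eq_defect k E).symm.trans h)
    rw [← h₁, smul_smul] at h₃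
    rw [← smul_right_injective A (three_ne_zero (α := k)) |>.eq_iff, h₃, smul_smul]
    norm_num
  | r + 3 =>
    refine step (r + 2) rfl ?_
    have h₂ := hE.smul_defect_two (fun i j hij => ih (r + 2) (by omega) hij)
      (fun i j hij => ih (r + 1) (by omega) hij)
    rw [show r + 4 = r + 3 + 1 by ring, ← h₁, smul_smul] at h₂
    rw [← smul_right_injective A (natCast_add_four_ne_zero k r) |>.eq_iff]
    push_cast at h₂ ⊢
    linear_combination (norm := module) h₂

theorem comm_unitDefect (hE : IsWittFamily k E) (h : sextic E = 0) (m t : ℕ) :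
    E m * unitDefect k E t - unitDefect k E t * E m
      = ((t : k) + 4) • unitDefect k E (m + t + 1) := by
  have hc := hE.comm_defect m 1 (t + 1)
  rw [hE.defect_eq h t (i := 1) (j := t + 1) (by ring),
    hE.defect_eq h (m + t + 1) (i := m + 1 + 1) (by ring),
    hE.defect_eq h (m + t + 1) (i := 1) (by ring),
    hE.defect_eq h (m + t + 1) (i := m + 1) (by ring)] at hc
  rw [← smul_right_injective A (Nat.cast_add_one_ne_zero t : (t : k) + 1 ≠ 0) |>.eq_iff]
  simp only [mul_smul_comm, smul_mul_assoc] at hc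
  push_cast at hc
  linear_combination (norm := module) hc

theorem mul_eq (hE : IsWittFamily k E) (h : sextic E = 0) (i j : ℕ) :
    E (i + 1) * E (j + 1) = E 0 * E (i + j + 2) - ((i : k) + 1) • E (i + j + 3)
      + (((i : k) + 1) * (j + 1)) • unitDefect k E (i + j) := by
  have hd := hE.defect_eq h (i + j) (i := i + 1) (j := j + 1) (by ring)
  rw [defect, show i + 1 + (j + 1) = i + j + 2 by ring] at hd
  push_cast at hd
  linear_combination (norm := module) hd

theorem sextic_eq_zero_of_quartic (hE : IsWittFamily k E) (h : quartic E = 0) : sextic E = 0 := by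
  have h11 : defect k E 1 1 = 0 := neg_eq_zero.mp (quartic_eq_defect k E ▸ h)
  have h12 : defect k E 1 2 = 0 := by
    have := hE.comm_defect 0 1 1
    rw [h11, hE.defect_comm _ 1, mul_zero, zero_mul, sub_zero] at this
    simpa [← two_smul k, two_ne_zero] using this.symm
  have h22 : defect k E 2 2 = 0 := by
    simpa [h11] using (hE.comm_defect 1 1 1).symm
  have h13 : defect k E 1 3 = 0 := by
    simpa [h12, h22] using (hE.comm_defect 0 1 2).symm
  rw [sextic_eq_defect k, h22, h13, smul_zero, smul_zero, sub_zero]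

theorem unitDefect_eq_zero (hE : IsWittFamily k E) (h : quartic E = 0) (t : ℕ) :
    unitDefect k E t = 0 := by
  induction t with
  | zero =>
    simpa [quartic_eq_defect k, ← smul_unitDefect k E 0] using h
  | succ t ih =>
    have hc := hE.comm_unitDefect (hE.sextic_eq_zero_of_quartic h) 0 t
    simpa [ih, natCast_add_four_ne_zero k t] using hc.symm

theorem cubicRel_eq_zero_of_quartic (hE : IsWittFamily k E) (h : quartic E = 0) {a : k}
    (ha : a ^ 2 = a) (n t : ℕ) : cubicRel E a n t = 0 := by
  simp [cubicRel, hE.unitDefect_eq_zero h, ha]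

theorem comm_cubicRel (hE : IsWittFamily k E) (h : sextic E = 0) (a : k) (m n t : ℕ) :
    E m * cubicRel E a n t - cubicRel E a n t * E m
      = ((n : k) - m) • cubicRel E a (m + n + 1) t
        + ((t : k) + 4) • cubicRel E a n (m + t + 1) := by
  have hprod := congrArg₂ (· + ·) (congrArg (· * unitDefect k E t) (hE m n))
    (congrArg (E n * ·) (hE.comm_unitDefect h m t))
  have hlin := hE m (n + t + 4)
  have hunit := hE.comm_unitDefect h m (n + t + 1)
  simp only [cubicRel, mul_sub, sub_mul, smul_mul_assoc, mul_smul_comm, mul_assoc] at hprod ⊢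
  rw [show m + (n + t + 4) + 1 = m + n + t + 5 by ring] at hlin
  rw [show m + (n + t + 1) + 1 = m + n + t + 2 by ring] at hunit
  rw [show m + n + 1 + t + 4 = m + n + t + 5 by ring,
    show n + (m + t + 1) + 4 = m + n + t + 5 by ring,
    show m + n + 1 + t + 1 = m + n + t + 2 by ring,
    show n + (m + t + 1) + 1 = m + n + t + 2 by ring]
  push_cast at hlin hunit ⊢
  linear_combination (norm := module)
    hprod - (a ^ 2 - a) • hlin - (((t : k) + 4) * a) • hunit

theorem cubicRel_eq_zero (hE : IsWittFamily k E) (h : sextic E = 0) {a : k}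
    (h₀ : cubicRel E a 0 0 = 0) (h₁ : cubicRel E a 1 0 = 0) (n t : ℕ) :
    cubicRel E a n t = 0 := by
  have r₀ : ∀ t, cubicRel E a 0 t = 0 := fun t => by
    induction t with
    | zero => exact h₀
    | succ t ih =>
      simpa [ih, natCast_add_four_ne_zero k t] using (hE.comm_cubicRel h a 0 0 t).symm
  have r₂ : ∀ t, cubicRel E a 2 t = 0 := fun t => by
    simpa [r₀] using (hE.comm_cubicRel h a 1 0 t).symm
  have r₁ : ∀ t, cubicRel E a 1 t = 0 := fun t => by
    induction t with
    | zero => exact h₁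
    | succ t ih =>
      simpa [ih, r₂, natCast_add_four_ne_zero k t] using (hE.comm_cubicRel h a 0 1 t).symm
  induction n generalizing t with
  | zero => exact r₀ t
  | succ n ih =>
    rcases n with _ | n
    · exact r₁ t
    · simpa [ih, Nat.cast_add_one_ne_zero (R := k) n] using
        (hE.comm_cubicRel h a 0 (n + 1) t).symm

end IsWittFamily

section Cubic

variable {k}

theorem cubicRel_zero_zero (E : ℕ → A) (a : k) :
    cubicRel E a 0 0 = E 0 * E 1 ^ 2 - E 0 ^ 2 * E 2 - (2 * a) • (E 1 * E 2)
      + (1 + 2 * a) • (E 0 * E 3) - (a ^ 2 + a) • E 4 := by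
  have z₀ := smul_unitDefect_eq k E 0
  have z₁ := smul_unitDefect_eq k E 1
  norm_num at z₀ z₁
  simp only [cubicRel, z₀, mul_add, mul_sub, sq, mul_assoc, zero_add]
  push_cast
  linear_combination (norm := module) (-(2 * a)) • z₁

theorem IsWittFamily.cubic_generator_eq {E : ℕ → A} (hE : IsWittFamily k E) (a : k) :
    -(4 * (E 0 ^ 2 * E 1 ^ 2)) - 4 * E 1 ^ 3 + 4 * (E 0 ^ 3 * E 2)
      + (20 * a ^ 2 + 14 * a - 7) • E 2 ^ 2 - (16 * a ^ 2 + 18 * a + 5) • (E 0 * E 4)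
      + (16 * a ^ 3 + 36 * a ^ 2 + 16 * a - 2) • E 5
    = -((4 : k) • (E 0 * cubicRel E a 0 0)) - (4 : k) • cubicRel E a 1 0
      - (16 * a + 8) • cubicRel E a 0 1 + ((20 * a ^ 2 + 14 * a - 3) / 3) • sextic E := by
  have z₀ := smul_unitDefect_eq k E 0
  have z₁ := smul_unitDefect_eq k E 1
  have z₂ := smul_unitDefect_eq k E 2
  norm_num at z₀ z₁ z₂
  have z₁' := congrArg (E 0 * ·) z₁
  have c₁ := congrArg (· * E 2) (hE 1 0)
  rw [cubicRel_zero_zero, cubicRel, cubicRel, z₀, sextic]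
  simp only [mul_add, mul_sub, sub_mul, pow_succ, pow_zero, one_mul, mul_assoc, zero_add,
    ofNat_mul_eq_smul k, mul_smul_comm, smul_mul_assoc] at z₁' c₁ ⊢
  norm_num at c₁ z₁' ⊢
  linear_combination (norm := module) (8 * a + 4) • z₁' - ((80 * a ^ 2 + 56 * a) / 3) • z₂
    - (4 : k) • c₁

end Cubic

end WittFamily

/-! ### Normal forms -/

section NormalForm

/-- The normal forms `e₁ⁱ` and `e₁ⁱ e (n + 2)` modulo the quartic relation. -/
def quarticNormalForm {A : Type*} [Ring A] (E : ℕ → A) : ℕ ⊕ ℕ × ℕ → A :=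
  Sum.elim (fun i => E 0 ^ i) fun p => E 0 ^ p.1 * E (p.2 + 1)

/-- The normal forms `e₁ⁱ`, `e₁ⁱ e (n + 2)` and `Z t` modulo the sextic and cubic relations. -/
def cubicNormalForm (k : Type*) [Field k] {A : Type*} [Ring A] [Algebra k A] (E : ℕ → A) :
    (ℕ ⊕ ℕ × ℕ) ⊕ ℕ → A :=
  Sum.elim (quarticNormalForm E) (unitDefect k E)

/-- The normal forms `e₁ⁱ` and `e₁ⁱ e₂ʲ e (n + 2)` modulo the sextic relation. -/
def sexticNormalForm {A : Type*} [Ring A] (E : ℕ → A) : ℕ ⊕ ℕ × ℕ × ℕ → A :=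
  Sum.elim (fun i => E 0 ^ i) fun p => E 0 ^ p.1 * E 1 ^ p.2.1 * E (p.2.2 + 1)

/-- The span of the normal forms modulo the sextic relation that have length at most `r`. -/
def sexticSpan (k : Type*) [Field k] {A : Type*} [Ring A] [Algebra k A] (E : ℕ → A) (r : ℕ) :
    Submodule k A :=
  Submodule.span k (sexticNormalForm E '' {p | Sum.elim id (fun q => q.1 + q.2.1 + 1) p ≤ r})

variable {k : Type*} [Field k] {A : Type*} [Ring A] [Algebra k A] {E : ℕ → A}

theorem map_quarticNormalForm {B : Type*} [Ring B] [Algebra k B] (f : A →ₐ[k] B) (E : ℕ → A) :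
    f ∘ quarticNormalForm E = quarticNormalForm (f ∘ E) := by
  ext (i | p) <;> simp [quarticNormalForm]

theorem map_cubicNormalForm {B : Type*} [Ring B] [Algebra k B] (f : A →ₐ[k] B) (E : ℕ → A) :
    f ∘ cubicNormalForm k E = cubicNormalForm k (f ∘ E) := by
  ext ((i | p) | t) <;> simp [cubicNormalForm, quarticNormalForm, map_unitDefect]

theorem map_sexticNormalForm {B : Type*} [Ring B] [Algebra k B] (f : A →ₐ[k] B) (E : ℕ → A) :
    f ∘ sexticNormalForm E = sexticNormalForm (f ∘ E) := by
  ext (i | p) <;> simp [sexticNormalForm]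

namespace IsWittFamily

theorem zero_mul_mem_span_cubicNormalForm {a : k} (hc : ∀ n t, cubicRel E a n t = 0) {y : A}
    (hy : y ∈ Submodule.span k (Set.range (cubicNormalForm k E))) :
    E 0 * y ∈ Submodule.span k (Set.range (cubicNormalForm k E)) := by
  have mem : ∀ p, cubicNormalForm k E p ∈ Submodule.span k (Set.range (cubicNormalForm k E)) :=
    fun p => Submodule.subset_span ⟨p, rfl⟩
  refine mul_mem_span_range ?_ hy
  rintro ((i | ⟨i, n⟩) | t)
  · simpa only [cubicNormalForm, quarticNormalForm, Sum.elim_inl, pow_succ'] using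
      mem (Sum.inl (Sum.inl (i + 1)))
  · simpa only [cubicNormalForm, quarticNormalForm, Sum.elim_inl, Sum.elim_inr, pow_succ',
      mul_assoc] using mem (Sum.inl (Sum.inr (i + 1, n)))
  · have hZ : E 0 * unitDefect k E t = (a ^ 2 - a) • (E 0 ^ 0 * E (t + 3 + 1))
        + (((t : k) + 4) * a) • unitDefect k E (t + 1) := by
      have := hc 0 t
      rw [cubicRel, zero_add] at this
      rw [pow_zero, one_mul]
      linear_combination (norm := module) this
    simp only [cubicNormalForm, Sum.elim_inr, hZ]
    exact add_mem (Submodule.smul_mem _ _ (mem (Sum.inl (Sum.inr (0, t + 3)))))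
      (Submodule.smul_mem _ _ (mem (Sum.inr (t + 1))))

variable [CharZero k]

theorem mem_span_cubicNormalForm (hE : IsWittFamily k E) (h : sextic E = 0) {a : k}
    (hc : ∀ n t, cubicRel E a n t = 0) {x : A} (hx : x ∈ Algebra.adjoin k (Set.range E)) :
    x ∈ Submodule.span k (Set.range (cubicNormalForm k E)) := by
  set N := Submodule.span k (Set.range (cubicNormalForm k E))
  have mem : ∀ p, cubicNormalForm k E p ∈ N := fun p => Submodule.subset_span ⟨p, rfl⟩
  have mem_unitDefect : ∀ t, unitDefect k E t ∈ N := fun t => mem (Sum.inr t)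
  have mem_gen : ∀ m, E m ∈ N := fun m => by
    rcases m with _ | m
    · simpa [cubicNormalForm, quarticNormalForm] using mem (Sum.inl (Sum.inl 1))
    · simpa [cubicNormalForm, quarticNormalForm] using mem (Sum.inl (Sum.inr (0, m)))
  have zero_pow_mul : ∀ i, ∀ y ∈ N, E 0 ^ i * y ∈ N := fun i y hy => by
    induction i with
    | zero => simpa using hy
    | succ i ih =>
      rw [pow_succ', mul_assoc]
      exact zero_mul_mem_span_cubicNormalForm hc ih
  have succ_mul : ∀ n m, E (n + 1) * E m ∈ N := fun n m => by
    rcases m with _ | m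
    · rw [hE.mul_zero_eq]
      exact sub_mem (zero_mul_mem_span_cubicNormalForm hc (mem_gen _)) (N.smul_mem _ (mem_gen _))
    · rw [hE.mul_eq h]
      exact add_mem (sub_mem (zero_mul_mem_span_cubicNormalForm hc (mem_gen _))
        (N.smul_mem _ (mem_gen _))) (N.smul_mem _ (mem_unitDefect _))
  refine mem_of_mem_adjoin_right ?_ ?_ hx
  · simpa [cubicNormalForm, quarticNormalForm] using mem (Sum.inl (Sum.inl 0))
  rintro _ ⟨m, rfl⟩ y hy
  refine mul_mem_span_range_right ?_ hy
  rintro ((i | ⟨i, n⟩) | t)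
  · exact zero_pow_mul i _ (mem_gen m)
  · simp only [cubicNormalForm, quarticNormalForm, Sum.elim_inl, Sum.elim_inr, mul_assoc]
    exact zero_pow_mul i _ (succ_mul n m)
  · have hZ : unitDefect k E t * E m = cubicRel E a m t + (a ^ 2 - a) • E (m + t + 4)
        + ((t + 4 : k) * a - (t + 4)) • unitDefect k E (m + t + 1) := by
      rw [cubicRel]
      linear_combination (norm := module) -hE.comm_unitDefect h m t
    simp only [cubicNormalForm, Sum.elim_inr, hZ, hc, zero_add]
    exact add_mem (N.smul_mem _ (mem_gen _)) (N.smul_mem _ (mem_unitDefect _))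

theorem mem_span_quarticNormalForm (hE : IsWittFamily k E) (h : quartic E = 0) {x : A}
    (hx : x ∈ Algebra.adjoin k (Set.range E)) :
    x ∈ Submodule.span k (Set.range (quarticNormalForm E)) := by
  have hmem := hE.mem_span_cubicNormalForm (hE.sextic_eq_zero_of_quartic h)
    (hE.cubicRel_eq_zero_of_quartic h (a := 0) (by simp)) hx
  refine Submodule.span_le.mpr ?_ hmem
  rintro _ ⟨p | t, rfl⟩
  · exact Submodule.subset_span ⟨p, rfl⟩
  · simp [cubicNormalForm, hE.unitDefect_eq_zero h]

end IsWittFamily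

theorem sexticSpan_mono {r s : ℕ} (h : r ≤ s) : sexticSpan k E r ≤ sexticSpan k E s :=
  Submodule.span_mono (Set.image_mono fun _ hp => le_trans hp h)

theorem pow_mem_sexticSpan {i r : ℕ} (h : i ≤ r) : E 0 ^ i ∈ sexticSpan k E r :=
  Submodule.subset_span ⟨Sum.inl i, h, rfl⟩

theorem mul_mem_sexticSpan {i j r : ℕ} (h : i + j + 1 ≤ r) (n : ℕ) :
    E 0 ^ i * E 1 ^ j * E (n + 1) ∈ sexticSpan k E r :=
  Submodule.subset_span ⟨Sum.inr (i, j, n), h, rfl⟩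

namespace IsWittFamily

theorem comm_pow_mem (hE : IsWittFamily k E) (j : ℕ) :
    E 0 * E 1 ^ j - E 1 ^ j * E 0 ∈ Submodule.span k (Set.range E) ^ j := by
  have mem : ∀ m, E m ∈ Submodule.span k (Set.range E) := fun m => Submodule.subset_span ⟨m, rfl⟩
  induction j with
  | zero => simp
  | succ j ih =>
    have h := hE 0 1
    have hsplit : E 0 * E 1 ^ (j + 1) - E 1 ^ (j + 1) * E 0
        = (E 0 * E 1 ^ j - E 1 ^ j * E 0) * E 1 + E 1 ^ j * E 2 := by
      rw [Nat.cast_one, Nat.cast_zero, sub_zero, one_smul] at h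
      rw [← h, pow_succ]
      noncomm_ring
    rw [hsplit, pow_succ]
    exact add_mem (Submodule.mul_mem_mul ih (mem 1))
      (Submodule.mul_mem_mul (Submodule.pow_mem_pow _ (mem 1) j) (mem 2))

variable [CharZero k]

theorem exists_succ_mul_eq (hE : IsWittFamily k E) (h : sextic E = 0) (n m : ℕ) :
    ∃ (α β γ : k) (p : ℕ), E (n + 1) * E m =
      α • (E 0 * E (n + m + 1)) + β • (E 1 * E (p + 1)) + γ • E (n + m + 1 + 1) := by
  rcases m with _ | m
  · refine ⟨1, 0, -(n + 1), 0, ?_⟩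
    rw [hE.mul_zero_eq]
    module
  · have hZ : unitDefect k E (n + m) = ((n + m : ℕ) + 1 : k)⁻¹ •
        (E 1 * E (n + m + 1) - E 0 * E (n + m + 2) + E (n + m + 3)) := by
      rw [← smul_unitDefect_eq k, inv_smul_smul₀ (Nat.cast_add_one_ne_zero _)]
    have hmul := hE.mul_eq h n m
    rw [hZ] at hmul
    set c : k := ((n + m : ℕ) + 1 : k)⁻¹
    refine ⟨1 - (n + 1) * (m + 1) * c, (n + 1) * (m + 1) * c, (n + 1) * (m + 1) * c - (n + 1),
      n + m, ?_⟩
    rw [hmul, ← add_assoc n m 1]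
    module

theorem mul_mem_sexticSpan_succ (hE : IsWittFamily k E) (h : sextic E = 0) {r : ℕ}
    (hr : ∀ s ≤ r, Submodule.span k (Set.range E) ^ s ≤ sexticSpan k E r) {x : A}
    (hx : x ∈ sexticSpan k E r) (m : ℕ) : x * E m ∈ sexticSpan k E (r + 1) := by
  have mem : ∀ m, E m ∈ Submodule.span k (Set.range E) := fun m => Submodule.subset_span ⟨m, rfl⟩
  refine (Submodule.map_span_le (LinearMap.mulRight k (E m)) _ _).mpr ?_
    (Submodule.mem_map_of_mem hx)
  rintro _ ⟨i | ⟨i, j, n⟩, hlen, rfl⟩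
  · replace hlen : i ≤ r := hlen
    change E 0 ^ i * E m ∈ _
    rcases m with _ | m
    · rw [← pow_succ]; exact pow_mem_sexticSpan (by omega)
    · simpa using mul_mem_sexticSpan (k := k) (E := E) (j := 0) (show i + 0 + 1 ≤ r + 1 by omega) m
  · replace hlen : i + j + 1 ≤ r := hlen
    change E 0 ^ i * E 1 ^ j * E (n + 1) * E m ∈ _
    obtain ⟨α, β, γ, p, hmul⟩ := hE.exists_succ_mul_eq h n m
    have hcomm : E 0 ^ i * (E 0 * E 1 ^ j - E 1 ^ j * E 0) * E (n + m + 1)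
        ∈ sexticSpan k E (r + 1) := by
      refine sexticSpan_mono r.le_succ (hr _ hlen ?_)
      rw [pow_succ, pow_add]
      exact Submodule.mul_mem_mul (Submodule.mul_mem_mul (Submodule.pow_mem_pow _ (mem 0) i)
        (hE.comm_pow_mem j)) (mem _)
    have hexpand : E 0 ^ i * E 1 ^ j * E (n + 1) * E m
        = α • (E 0 ^ (i + 1) * E 1 ^ j * E (n + m + 1)
            - E 0 ^ i * (E 0 * E 1 ^ j - E 1 ^ j * E 0) * E (n + m + 1))
          + β • (E 0 ^ i * E 1 ^ (j + 1) * E (p + 1))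
          + γ • (E 0 ^ i * E 1 ^ j * E (n + m + 1 + 1)) := by
      rw [mul_assoc, hmul]
      simp only [mul_add, mul_sub, sub_mul, mul_smul_comm, pow_succ, mul_assoc]
      module
    rw [hexpand]
    exact add_mem (add_mem
      (Submodule.smul_mem _ _ (sub_mem (mul_mem_sexticSpan (by omega) _) hcomm))
      (Submodule.smul_mem _ _ (mul_mem_sexticSpan (by omega) _)))
      (Submodule.smul_mem _ _ (mul_mem_sexticSpan (by omega) _))

theorem span_pow_le_sexticSpan (hE : IsWittFamily k E) (h : sextic E = 0) (r : ℕ) :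
    Submodule.span k (Set.range E) ^ r ≤ sexticSpan k E r := by
  induction r using Nat.strong_induction_on with
  | _ r ih =>
  rcases r with _ | r
  · rw [pow_zero, Submodule.one_le]
    simpa using pow_mem_sexticSpan (k := k) (E := E) (le_refl 0)
  · rw [pow_succ]
    refine Submodule.mul_le.mpr fun x hx y hy => mul_mem_span_range (fun m => ?_) hy
    exact hE.mul_mem_sexticSpan_succ h
      (fun s hs => (ih s (by omega)).trans (sexticSpan_mono hs)) (ih r r.lt_succ_self hx) m

theorem mem_span_sexticNormalForm (hE : IsWittFamily k E) (h : sextic E = 0) {x : A}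
    (hx : x ∈ Algebra.adjoin k (Set.range E)) :
    x ∈ Submodule.span k (Set.range (sexticNormalForm E)) := by
  have sexticSpan_le : ∀ r, sexticSpan k E r ≤ Submodule.span k (Set.range (sexticNormalForm E)) :=
    fun r => Submodule.span_mono (Set.image_subset_range _ _)
  refine mem_of_mem_adjoin_right ?_ ?_ hx
  · simpa using sexticSpan_le 0 (pow_mem_sexticSpan le_rfl)
  rintro _ ⟨m, rfl⟩ y hy
  refine mul_mem_span_range_right (fun p => ?_) hy
  obtain ⟨r, hr⟩ : ∃ r, sexticNormalForm E p ∈ sexticSpan k E r :=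
    ⟨Sum.elim id (fun q => q.1 + q.2.1 + 1) p, Submodule.subset_span ⟨p, le_refl (α := ℕ) _, rfl⟩⟩
  exact sexticSpan_le _ (hE.mul_mem_sexticSpan_succ h
    (fun s hs => (hE.span_pow_le_sexticSpan h s).trans (sexticSpan_mono hs)) hr m)

end IsWittFamily

end NormalForm

section Model

variable {k : Type*} [Field k] {A : Type*} [Ring A] [Algebra k A] {u v w : A}

variable (k) in
/-- The family `(u - i w) vⁱ`, which satisfies the relations of `W₊` when `u`, `v`, `w` satisfy the
relations of `S`. Both `φ` and the `λ_a` are of this form. -/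
def modelFamily (u v w : A) (i : ℕ) : A := (u - (i : k) • w) * v ^ i

theorem map_modelFamily {B : Type*} [Ring B] [Algebra k B] (f : A →ₐ[k] B) (u v w : A) :
    f ∘ modelFamily k u v w = modelFamily k (f u) (f v) (f w) := by
  ext i
  simp [modelFamily]

theorem defect_modelFamily (h₁ : u * v - v * u - v ^ 2 = 0) (h₂ : u * w - w * u - v * w = 0)
    (h₃ : v * w - w * v = 0) (i j : ℕ) : defect k (modelFamily k u v w) i j =
      ((i : k) * j) • (w * w * v ^ (i + j) - w * v ^ (i + j + 1)) := by
  have hvw : Commute v w := sub_eq_zero.mp h₃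
  have hpow : v ^ i * ((u - (j : k) • w) * v ^ j)
      = u * v ^ (i + j) - (i : k) • v ^ (i + j + 1) - (j : k) • (w * v ^ (i + j)) := by
    rw [← mul_assoc, mul_sub, WittPos.pow_mul_comm_aux (k := k) h₁, mul_smul_comm,
      (hvw.pow_left i).eq, sub_mul, sub_mul, smul_mul_assoc, smul_mul_assoc, mul_assoc,
      mul_assoc, ← pow_add, ← pow_add, Nat.add_right_comm i 1 j]
  have huw : u * (w * v ^ (i + j)) = w * (u * v ^ (i + j)) + w * v ^ (i + j + 1) := by
    rw [pow_succ', ← mul_assoc w v, ← hvw.eq, ← sub_eq_zero, ← zero_mul (v ^ (i + j)), ← h₂]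
    noncomm_ring
  simp only [defect, modelFamily, mul_assoc, hpow]
  simp only [Nat.cast_zero, zero_smul, sub_zero, pow_zero, one_mul, sub_mul, mul_sub,
    smul_mul_assoc, mul_smul_comm, huw]
  push_cast
  module

theorem unitDefect_modelFamily [CharZero k] (h₁ : u * v - v * u - v ^ 2 = 0)
    (h₂ : u * w - w * u - v * w = 0) (h₃ : v * w - w * v = 0) (t : ℕ) :
    unitDefect k (modelFamily k u v w) t = w * w * v ^ (t + 2) - w * v ^ (t + 3) := by
  rw [unitDefect, defect_modelFamily h₁ h₂ h₃, Nat.cast_one, one_mul, Nat.cast_succ,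
    inv_smul_smul₀ (Nat.cast_add_one_ne_zero t), add_comm 1 (t + 1)]

theorem sextic_modelFamily (h₁ : u * v - v * u - v ^ 2 = 0) (h₂ : u * w - w * u - v * w = 0)
    (h₃ : v * w - w * v = 0) : sextic (modelFamily k u v w) = 0 := by
  rw [sextic_eq_defect (k := k), defect_modelFamily h₁ h₂ h₃, defect_modelFamily h₁ h₂ h₃]
  push_cast
  module

theorem smul_rel (h₁ : u * v - v * u - v ^ 2 = 0) (a : k) :
    u * (a • v) - a • v * u - v * (a • v) = 0 := by
  rw [mul_smul_comm, smul_mul_assoc, mul_smul_comm, ← smul_sub, ← smul_sub, ← sq, h₁, smul_zero]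

theorem mul_smul_self_sub (v : A) (a : k) : v * (a • v) - a • v * v = 0 := by
  rw [mul_smul_comm, smul_mul_assoc, sub_self]

theorem unitDefect_modelFamily_smul [CharZero k] (h₁ : u * v - v * u - v ^ 2 = 0) (a : k) (t : ℕ) :
    unitDefect k (modelFamily k u v (a • v)) t = (a ^ 2 - a) • v ^ (t + 4) := by
  rw [unitDefect_modelFamily h₁ (smul_rel h₁ a) (mul_smul_self_sub v a), smul_mul_smul_comm,
    smul_mul_assoc, smul_mul_assoc, mul_assoc, ← pow_succ', ← pow_succ', sub_smul, sq]

theorem quartic_modelFamily_smul (h₁ : u * v - v * u - v ^ 2 = 0) {a : k} (ha : a ^ 2 - a = 0) :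
    quartic (modelFamily k u v (a • v)) = 0 := by
  rw [quartic_eq_defect k, defect_modelFamily h₁ (smul_rel h₁ a) (mul_smul_self_sub v a),
    smul_mul_smul_comm, smul_mul_assoc, smul_mul_assoc, mul_assoc, ← pow_succ', ← pow_succ',
    ← sub_smul, ← sq a, ha, zero_smul, smul_zero, neg_zero]

theorem cubicRel_modelFamily_smul [CharZero k] (h₁ : u * v - v * u - v ^ 2 = 0) (a : k) (n t : ℕ) :
    cubicRel (modelFamily k u v (a • v)) a n t = 0 := by
  simp only [cubicRel, unitDefect_modelFamily_smul h₁]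
  simp only [modelFamily, mul_smul_comm, smul_mul_assoc, sub_mul, mul_assoc, ← pow_add,
    ← pow_succ']
  simp only [show n + (t + 4) = n + t + 4 by ring, show n + t + 4 + 1 = n + t + 1 + 4 by ring,
    show n + 1 + (t + 4) = n + t + 1 + 4 by ring]
  push_cast
  module

end Model

/-! ### The generators of `U(W₊)` -/

namespace UWittPos

variable (k : Type*) [Field k]

/-- The generators of `U(W₊)`, indexed from `0`: `gen i = e (i + 1)`. -/
noncomputable def gen (i : ℕ) : UWittPos k := e k i.succPNat

section

attribute [local instance 100] LieRing.ofAssociativeRing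

theorem isWittFamily_gen : IsWittFamily k (gen k) := fun i j => by
  have h : ⁅WittPos.e k i.succPNat, WittPos.e k j.succPNat⁆
      = ((j : k) - i) • WittPos.e k (i + j + 1).succPNat := by
    refine Subtype.ext ((Witt.lie_e k _ _).trans ?_)
    change _ = ((j : k) - i) • Witt.e k _
    congr 1
    · push_cast; simp
    · congr 1; push_cast [Nat.succPNat_coe]; ring
  have hι := congrArg (UniversalEnvelopingAlgebra.ι k) h
  rwa [LieHom.map_lie, map_smul, LieRing.of_associative_ring_bracket] at hι

theorem ι_mem_adjoin_gen (x : WittPos k) :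
    UniversalEnvelopingAlgebra.ι k x ∈ Algebra.adjoin k (Set.range (gen k)) := by
  obtain ⟨x, hx⟩ := x
  have hspan : x ∈ Submodule.span k {x | ∃ n : ℤ, 1 ≤ n ∧ x = Witt.e k n} := by
    rwa [← WittPos.toSubmodule_eq]
  induction hspan using Submodule.span_induction with
  | zero => exact (map_zero (UniversalEnvelopingAlgebra.ι k (L := WittPos k))).symm ▸ zero_mem _
  | add x y hx' hy' ihx ihy =>
    rw [← WittPos.toSubmodule_eq] at hx' hy'
    have := add_mem (ihx hx') (ihy hy')
    rwa [← map_add] at this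
  | smul c x hx' ihx =>
    rw [← WittPos.toSubmodule_eq] at hx'
    have := Subalgebra.smul_mem _ (ihx hx') c
    rwa [← map_smul] at this
  | mem x hx' =>
    obtain ⟨n, hn, rfl⟩ := hx'
    obtain ⟨i, rfl⟩ : ∃ i : ℕ, n = i + 1 := ⟨(n - 1).toNat, by omega⟩
    exact Algebra.subset_adjoin ⟨i, rfl⟩

end

theorem adjoin_gen : Algebra.adjoin k (Set.range (gen k)) = ⊤ := by
  have hsurj : (UniversalEnvelopingAlgebra.mkAlgHom k (WittPos k)).range = ⊤ :=
    (AlgHom.range_eq_top _).mpr (RingCon.mkₐ_surjective _)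
  rw [← top_le_iff, ← hsurj, ← Algebra.map_top, ← TensorAlgebra.adjoin_range_ι, AlgHom.map_adjoin,
    Algebra.adjoin_le_iff]
  rintro _ ⟨_, ⟨x, rfl⟩, rfl⟩
  exact ι_mem_adjoin_gen k x

variable {k}

theorem range_eq_adjoin {A : Type*} [Ring A] [Algebra k A] (f : UWittPos k →ₐ[k] A) :
    f.range = Algebra.adjoin k (Set.range (f ∘ gen k)) := by
  rw [← Algebra.map_top, ← adjoin_gen, AlgHom.map_adjoin, Set.range_comp]

theorem map_mem_adjoin {A : Type*} [Ring A] [Algebra k A] (f : UWittPos k →ₐ[k] A)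
    (x : UWittPos k) : f x ∈ Algebra.adjoin k (Set.range (f ∘ gen k)) :=
  range_eq_adjoin f ▸ f.mem_range_self x

theorem lam_comp_gen (a : k) :
    lam a ∘ gen k = modelFamily k (JordanPlane.u k) (JordanPlane.v k) (a • JordanPlane.v k) := by
  ext i
  simp [gen, lam_e, modelFamily, smul_smul]

variable (k) in
theorem phi_comp_gen : phi k ∘ gen k = modelFamily k (SAlg.u k) (SAlg.v k) (SAlg.w k) := by
  ext i
  simp [gen, phi_e, modelFamily]

variable (k) in
theorem sextic_gen : sextic (gen k) = h₂ k := rfl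

theorem cubicRel_gen [CharZero k] (a : k) : cubicRel (gen k) a 0 0 = h₁ a := by
  rw [cubicRel_zero_zero]
  rfl

end UWittPos

/-! ### Monomial bases of `S` and `R` -/

theorem linearIndependent_of_apply_eq_single {k A M : Type*} [Field k] [Ring A] [Algebra k A]
    (ρ : A →ₐ[k] Module.End k (M →₀ k)) (y : M →₀ k) {f : M → A}
    (hf : ∀ μ, ρ (f μ) y = Finsupp.single μ 1) : LinearIndependent k f := by
  refine LinearIndependent.of_comp (LinearMap.applyₗ y ∘ₗ ρ.toLinearMap) ?_
  convert (Finsupp.basisSingleOne (R := k) (ι := M)).linearIndependent using 1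
  ext1 μ
  simp [hf]

namespace SAlg

variable {k : Type*} [Field k]

section lift

variable {B : Type*} [Ring B] [Algebra k B] (x y z : B) (h₁ : x * y - y * x - y ^ 2 = 0)
    (h₂ : x * z - z * x - y * z = 0) (h₃ : y * z - z * y = 0)

/-- The algebra map from `S` given by three elements that satisfy the defining relations. -/
noncomputable def lift : SAlg k →ₐ[k] B :=
  RingQuot.liftAlgHom k ⟨FreeAlgebra.lift k ![x, y, z], by
    rintro _ _ ⟨⟩
    · simpa using h₁
    · simpa using h₂
    · simpa using h₃⟩

@[simp]
theorem lift_u : lift (k := k) x y z h₁ h₂ h₃ (u k) = x :=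
  (RingQuot.liftAlgHom_mkAlgHom_apply k _ _ _).trans (by simp)

@[simp]
theorem lift_v : lift (k := k) x y z h₁ h₂ h₃ (v k) = y :=
  (RingQuot.liftAlgHom_mkAlgHom_apply k _ _ _).trans (by simp)

@[simp]
theorem lift_w : lift (k := k) x y z h₁ h₂ h₃ (w k) = z :=
  (RingQuot.liftAlgHom_mkAlgHom_apply k _ _ _).trans (by simp)

end lift

variable (k)

theorem adjoin_eq_top : Algebra.adjoin k {u k, v k, w k} = ⊤ := by
  have h : (mk k).range = ⊤ := (AlgHom.range_eq_top _).mpr (RingQuot.mkAlgHom_surjective k _)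
  rw [← h, ← Algebra.map_top, ← FreeAlgebra.adjoin_range_ι, AlgHom.map_adjoin, ← Set.range_comp]
  congr 1
  ext x
  simp [u, v, w, Fin.exists_fin_succ, eq_comm]

/-- The action of `u` on `k[x, y, v]`. -/
noncomputable def repU : Module.End k (ℕ × ℕ × ℕ →₀ k) :=
  Finsupp.linearCombination k fun p => Finsupp.single (p + (1, 0, 0)) 1
    + ((p.2.1 : k) + p.2.2) • Finsupp.single (p + (0, 0, 1)) 1

theorem repU_single (p : ℕ × ℕ × ℕ) (c : k) :
    repU k (Finsupp.single p c) = Finsupp.single (p + (1, 0, 0)) c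
      + ((p.2.1 : k) + p.2.2) • Finsupp.single (p + (0, 0, 1)) c := by
  rw [repU, Finsupp.linearCombination_single, smul_add, smul_comm c, Finsupp.smul_single_one,
    Finsupp.smul_single_one]

/-- The representation of `S` on `k[x, y, v]` in which `v` and `w` act as multiplication by `v`
and `y`, and `u` acts as `x + v D`, where `D` is the Euler operator in `y` and `v`. It turns out to
be the regular representation in the basis of monomials. -/
noncomputable def rep : SAlg k →ₐ[k] Module.End k (ℕ × ℕ × ℕ →₀ k) :=
  lift (repU k) (Finsupp.lmapDomain k k (· + (0, 0, 1))) (Finsupp.lmapDomain k k (· + (0, 1, 0)))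
    (by
      refine Finsupp.lhom_ext fun p c => ?_
      simp only [LinearMap.sub_apply, Module.End.mul_apply, sq, Finsupp.lmapDomain_apply,
        Finsupp.mapDomain_single, repU_single, Finsupp.mapDomain_add, Finsupp.mapDomain_smul,
        add_right_comm p, LinearMap.zero_apply, Prod.snd_add, Prod.fst_add]
      push_cast
      module)
    (by
      refine Finsupp.lhom_ext fun p c => ?_
      simp only [LinearMap.sub_apply, Module.End.mul_apply, Finsupp.lmapDomain_apply,
        Finsupp.mapDomain_single, repU_single, Finsupp.mapDomain_add, Finsupp.mapDomain_smul,
        add_right_comm p (0, 1, 0), LinearMap.zero_apply, Prod.snd_add, Prod.fst_add]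
      push_cast
      module)
    (by
      refine Finsupp.lhom_ext fun p c => ?_
      simp [add_right_comm])

/-- The monomials `v ^ d * w ^ b * u ^ a`, indexed by `(a, b, d)`. -/
noncomputable def mon (p : ℕ × ℕ × ℕ) : SAlg k := v k ^ p.2.2 * w k ^ p.2.1 * u k ^ p.1

theorem v_mul_mon (p : ℕ × ℕ × ℕ) : v k * mon k p = mon k (p + (0, 0, 1)) := by
  simp [mon, pow_succ', mul_assoc]

theorem w_mul_mon (p : ℕ × ℕ × ℕ) : w k * mon k p = mon k (p + (0, 1, 0)) := by
  have h : Commute (w k) (v k ^ p.2.2) := (Commute.symm (sub_eq_zero.mp (rel_vw k))).pow_right _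
  simp [mon, pow_succ', ← mul_assoc, h.eq]

theorem u_mul_w_pow (b : ℕ) : u k * w k ^ b = w k ^ b * u k + (b : k) • (v k * w k ^ b) := by
  have hvw : Commute (v k) (w k) := sub_eq_zero.mp (rel_vw k)
  have huw : u k * w k = w k * u k + v k * w k := by
    rw [← sub_eq_zero, ← sub_sub, rel_uw]
  induction b with
  | zero => simp
  | succ b ih =>
    rw [pow_succ, ← mul_assoc, ih, add_mul, mul_assoc, huw, mul_add, ← mul_assoc _ (v k),
      ← (hvw.pow_right b).eq, smul_mul_assoc, mul_assoc, mul_assoc]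
    push_cast
    module

theorem u_mul_mon (p : ℕ × ℕ × ℕ) : u k * mon k p =
    mon k (p + (1, 0, 0)) + ((p.2.1 : k) + p.2.2) • mon k (p + (0, 0, 1)) := by
  have huv : u k * v k ^ p.2.2 = v k ^ p.2.2 * u k + (p.2.2 : k) • v k ^ (p.2.2 + 1) := by
    rw [WittPos.pow_mul_comm_aux (k := k) (rel_uv k), sub_add_cancel]
  have huvw : u k * (v k ^ p.2.2 * w k ^ p.2.1) = v k ^ p.2.2 * w k ^ p.2.1 * u k
      + ((p.2.1 : k) + p.2.2) • (v k ^ (p.2.2 + 1) * w k ^ p.2.1) := by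
    rw [← mul_assoc, huv, add_mul, mul_assoc, u_mul_w_pow, mul_add, mul_smul_comm, smul_mul_assoc,
      ← mul_assoc, ← mul_assoc, ← pow_succ]
    module
  rw [mon, ← mul_assoc, huvw, add_mul, smul_mul_assoc, mul_assoc _ (u k), ← pow_succ']
  rfl

theorem rep_mon (p : ℕ × ℕ × ℕ) : rep k (mon k p) (Finsupp.single 0 1) = Finsupp.single p 1 := by
  obtain ⟨a, b, d⟩ := p
  have hu : (repU k ^ a) (Finsupp.single 0 1) = Finsupp.single (a, 0, 0) 1 := by
    induction a with
    | zero => rfl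
    | succ a ih => rw [pow_succ', Module.End.mul_apply, ih, repU_single]; simp
  have hshift : ∀ (δ p : ℕ × ℕ × ℕ) (n : ℕ), (Finsupp.lmapDomain k k (· + δ) ^ n)
      (Finsupp.single p 1) = Finsupp.single (p + n • δ) 1 := fun δ p n => by
    induction n with
    | zero => simp
    | succ n ih =>
      rw [pow_succ', Module.End.mul_apply, ih, Finsupp.lmapDomain_apply, Finsupp.mapDomain_single,
        succ_nsmul, add_assoc]
  simp only [mon, map_mul, map_pow, rep, lift_u, lift_v, lift_w, Module.End.mul_apply, hu, hshift]
  simp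

theorem span_mon : Submodule.span k (Set.range (mon k)) = ⊤ := by
  have mem : ∀ p, mon k p ∈ Submodule.span k (Set.range (mon k)) :=
    fun p => Submodule.subset_span ⟨p, rfl⟩
  refine eq_top_iff.mpr fun x _ => mem_of_mem_adjoin (s := {u k, v k, w k}) ?_ ?_
    (adjoin_eq_top k ▸ Algebra.mem_top)
  · simpa [mon] using mem 0
  rintro x hx y hy
  refine mul_mem_span_range (fun p => ?_) hy
  rcases hx with rfl | rfl | rfl
  · rw [u_mul_mon]
    exact add_mem (mem _) (Submodule.smul_mem _ _ (mem _))
  · exact v_mul_mon k p ▸ mem _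
  · exact w_mul_mon k p ▸ mem _

/-- The monomial basis of `S`. -/
noncomputable def monBasis : Module.Basis (ℕ × ℕ × ℕ) k (SAlg k) :=
  Module.Basis.mk (linearIndependent_of_apply_eq_single (rep k) (Finsupp.single 0 1) (rep_mon k))
    (span_mon k).ge

end SAlg

namespace JordanPlane

variable {k : Type*} [Field k]

section lift

variable {B : Type*} [Ring B] [Algebra k B] (x y : B) (h : x * y - y * x - y ^ 2 = 0)

/-- The algebra map from `R` given by two elements that satisfy the defining relation. -/
noncomputable def lift : JordanPlane k →ₐ[k] B :=
  RingQuot.liftAlgHom k ⟨FreeAlgebra.lift k ![x, y], by rintro _ _ ⟨⟩; simpa using h⟩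

@[simp]
theorem lift_u : lift (k := k) x y h (u k) = x :=
  (RingQuot.liftAlgHom_mkAlgHom_apply k _ _ _).trans (by simp)

@[simp]
theorem lift_v : lift (k := k) x y h (v k) = y :=
  (RingQuot.liftAlgHom_mkAlgHom_apply k _ _ _).trans (by simp)

end lift

variable (k)

theorem adjoin_eq_top : Algebra.adjoin k {u k, v k} = ⊤ := by
  have h : (mk k).range = ⊤ := (AlgHom.range_eq_top _).mpr (RingQuot.mkAlgHom_surjective k _)
  rw [← h, ← Algebra.map_top, ← FreeAlgebra.adjoin_range_ι, AlgHom.map_adjoin, ← Set.range_comp]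
  congr 1
  ext x
  simp [u, v, eq_comm]

/-- The monomials `v ^ j * u ^ i`, indexed by `(i, j)`. -/
noncomputable def mon (p : ℕ × ℕ) : JordanPlane k := v k ^ p.2 * u k ^ p.1

theorem v_mul_mon (p : ℕ × ℕ) : v k * mon k p = mon k (p + (0, 1)) := by
  simp [mon, pow_succ', mul_assoc]

theorem u_mul_mon (p : ℕ × ℕ) :
    u k * mon k p = mon k (p + (1, 0)) + (p.2 : k) • mon k (p + (0, 1)) := by
  have huv : u k * v k ^ p.2 = v k ^ p.2 * u k + (p.2 : k) • v k ^ (p.2 + 1) := by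
    rw [WittPos.pow_mul_comm_aux (k := k) (rel_uv k), sub_add_cancel]
  rw [mon, ← mul_assoc, huv, add_mul, smul_mul_assoc, mul_assoc _ (u k), ← pow_succ']
  rfl

theorem linearIndependent_mon : LinearIndependent k (mon k) := by
  have hinj : Function.Injective fun p : ℕ × ℕ => (p.1, 0, p.2) := fun p q h => by
    simpa [Prod.ext_iff] using h
  refine LinearIndependent.of_comp
    (lift (SAlg.u k) (SAlg.v k) (SAlg.rel_uv k)).toLinearMap ?_
  convert (SAlg.monBasis k).linearIndependent.comp _ hinj using 1
  ext1 p
  simp [mon, SAlg.monBasis, SAlg.mon]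

theorem span_mon : Submodule.span k (Set.range (mon k)) = ⊤ := by
  have mem : ∀ p, mon k p ∈ Submodule.span k (Set.range (mon k)) :=
    fun p => Submodule.subset_span ⟨p, rfl⟩
  refine eq_top_iff.mpr fun x _ => mem_of_mem_adjoin (s := {u k, v k}) ?_ ?_
    (adjoin_eq_top k ▸ Algebra.mem_top)
  · simpa [mon] using mem 0
  rintro x hx y hy
  refine mul_mem_span_range (fun p => ?_) hy
  rcases hx with rfl | rfl
  · rw [u_mul_mon]
    exact add_mem (mem _) (Submodule.smul_mem _ _ (mem _))
  · exact v_mul_mon k p ▸ mem _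

/-- The monomial basis of `R`. -/
noncomputable def monBasis : Module.Basis (ℕ × ℕ) k (JordanPlane k) :=
  Module.Basis.mk (linearIndependent_mon k) (span_mon k).ge

end JordanPlane

/-! ### Leading terms and kernels -/

namespace SAlg

variable {k : Type*} [Field k]

/-- The weight on the monomials of `S`: the degree in `u` and `w`, then the degree in `w`. -/
def wt (p : ℕ × ℕ × ℕ) : ℕ ×ₗ ℕ := toLex (p.1 + p.2.1, p.2.1)

theorem wt_lt {p q : ℕ × ℕ × ℕ} :
    wt p < wt q ↔ p.1 + p.2.1 < q.1 + q.2.1 ∨ p.1 + p.2.1 = q.1 + q.2.1 ∧ p.2.1 < q.2.1 :=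
  Prod.Lex.toLex_lt_toLex

theorem wt_add_lt_add (δ p q : ℕ × ℕ × ℕ) (h : wt p < wt q) : wt (p + δ) < wt (q + δ) := by
  simp only [wt_lt, Prod.fst_add, Prod.snd_add] at h ⊢
  omega

theorem hasLeading_mon (p : ℕ × ℕ × ℕ) : HasLeading (monBasis k) wt p (mon k p) := by
  simpa [monBasis] using hasLeading_basis (b := monBasis k) (wt := wt) p

theorem hasLeading_u_mul_mon (p : ℕ × ℕ × ℕ) :
    HasLeading (monBasis k) wt (p + (1, 0, 0)) (u k * mon k p) := by
  rw [u_mul_mon]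
  exact (hasLeading_mon _).add_smul (hasLeading_mon _) (wt_lt.mpr (by simp)) _

theorem hasLeading_sub_smul_w_mul_mon {c : k} (hc : c ≠ 0) (p : ℕ × ℕ × ℕ) :
    HasLeading (monBasis k) wt (p + (0, 1, 0)) ((u k - c • w k) * mon k p) := by
  have h := ((hasLeading_mon (p + (0, 1, 0))).smul (neg_ne_zero.mpr hc)).add_smul
    (hasLeading_u_mul_mon p) (wt_lt.mpr (by simp; omega)) 1
  rwa [← w_mul_mon, one_smul, neg_smul, neg_add_eq_sub, ← smul_mul_assoc, ← sub_mul] at h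

variable [CharZero k]

theorem hasLeading_modelFamily_succ_mul_mon (n : ℕ) (p : ℕ × ℕ × ℕ) :
    HasLeading (monBasis k) wt (p + (0, 1, n + 1))
      (modelFamily k (u k) (v k) (w k) (n + 1) * mon k p) := by
  have hv : ∀ m : ℕ, v k ^ m * mon k p = mon k (p + (0, 0, m)) := fun m => by
    simp [mon, pow_add, mul_assoc, add_comm p.2.2]
  have h := hasLeading_sub_smul_w_mul_mon (Nat.cast_ne_zero.mpr n.succ_ne_zero)
    (p + (0, 0, n + 1)) (k := k)
  rwa [← hv, ← mul_assoc, add_assoc] at h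

theorem linearIndependent_sexticNormalForm :
    LinearIndependent k (sexticNormalForm (modelFamily k (u k) (v k) (w k))) := by
  refine linearIndependent_of_hasLeading (b := monBasis k) (wt := wt)
    (σ := Sum.elim (fun i => (i, 0, 0)) fun q => (q.1, q.2.1 + 1, q.2.2 + 1 + q.2.1)) ?_ ?_
  · rintro (i | ⟨i, j, n⟩) (i' | ⟨i', j', n'⟩) h <;> simp at h ⊢ <;> omega
  have u_pow : ∀ (i : ℕ) {p : ℕ × ℕ × ℕ} {x : SAlg k}, HasLeading (monBasis k) wt p x →
      HasLeading (monBasis k) wt (p + i • (1, 0, 0)) (u k ^ i * x) := fun i p x hx =>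
    hx.pow_mul (wt_add_lt_add _) (fun μ => by simpa [monBasis] using hasLeading_u_mul_mon μ) i
  have one_pow : ∀ (j : ℕ) {p : ℕ × ℕ × ℕ} {x : SAlg k}, HasLeading (monBasis k) wt p x →
      HasLeading (monBasis k) wt (p + j • (0, 1, 1)) (modelFamily k (u k) (v k) (w k) 1 ^ j * x) :=
    fun j p x hx => hx.pow_mul (wt_add_lt_add _)
      (fun μ => by simpa [monBasis] using hasLeading_modelFamily_succ_mul_mon 0 μ) j
  have h0 : modelFamily k (u k) (v k) (w k) 0 = u k := by simp [modelFamily]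
  rintro (i | ⟨i, j, n⟩)
  · simpa [sexticNormalForm, h0, mon] using u_pow i (hasLeading_mon (k := k) 0)
  · have hn := hasLeading_modelFamily_succ_mul_mon n (0 : ℕ × ℕ × ℕ) (k := k)
    simpa [sexticNormalForm, h0, mon, mul_assoc, add_comm] using u_pow i (one_pow j hn)

end SAlg

namespace JordanPlane

variable {k : Type*} [Field k]

theorem hasLeading_mon (p : ℕ × ℕ) : HasLeading (monBasis k) toLex p (mon k p) := by
  simpa [monBasis] using hasLeading_basis (b := monBasis k) (wt := toLex) p

theorem toLex_add_lt_add (δ p q : ℕ × ℕ) (h : toLex p < toLex q) :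
    toLex (p + δ) < toLex (q + δ) :=
  add_lt_add_left h (toLex δ)

theorem hasLeading_v_pow_mul {p : ℕ × ℕ} {x : JordanPlane k}
    (hx : HasLeading (monBasis k) toLex p x) (j : ℕ) :
    HasLeading (monBasis k) toLex (p + j • (0, 1)) (v k ^ j * x) :=
  hx.pow_mul (toLex_add_lt_add _)
    (fun μ => by simpa [monBasis, v_mul_mon] using hasLeading_mon (μ + (0, 1))) j

theorem hasLeading_u_pow_mul {p : ℕ × ℕ} {x : JordanPlane k}
    (hx : HasLeading (monBasis k) toLex p x) (i : ℕ) :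
    HasLeading (monBasis k) toLex (p + i • (1, 0)) (u k ^ i * x) :=
  hx.pow_mul (toLex_add_lt_add _) (fun μ => by
    have h := (hasLeading_mon (μ + (1, 0))).add_smul (hasLeading_mon (μ + (0, 1)))
      (Prod.Lex.toLex_lt_toLex.mpr (by simp)) (μ.2 : k)
    simpa [monBasis, u_mul_mon] using h) i

theorem modelFamily_mul_u_pow (a : k) (n i : ℕ) :
    modelFamily k (u k) (v k) (a • v k) n * u k ^ i =
      mon k (i + 1, n) + ((n : k) * (1 - a)) • mon k (i, n + 1) := by
  have h : modelFamily k (u k) (v k) (a • v k) n * u k ^ i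
      = u k * mon k (i, n) - ((n : k) * a) • (v k * mon k (i, n)) := by
    rw [modelFamily, mon, smul_smul, mul_assoc, sub_mul, smul_mul_assoc]
  rw [h, u_mul_mon, v_mul_mon]
  simp only [Prod.mk_add_mk, add_zero]
  module

theorem hasLeading_modelFamily (a : k) (n : ℕ) :
    HasLeading (monBasis k) toLex (1, n) (modelFamily k (u k) (v k) (a • v k) n) := by
  rw [← mul_one (modelFamily k (u k) (v k) (a • v k) n), ← pow_zero (u k), modelFamily_mul_u_pow]
  exact (hasLeading_mon _).add_smul (hasLeading_mon _) (Prod.Lex.toLex_lt_toLex.mpr (by simp)) _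

theorem hasLeading_quarticNormalForm (a : k) (q : ℕ ⊕ ℕ × ℕ) :
    HasLeading (monBasis k) toLex (Sum.elim (fun i => (i, 0)) (fun q => (q.1 + 1, q.2 + 1)) q)
      (quarticNormalForm (modelFamily k (u k) (v k) (a • v k)) q) := by
  have h0 : modelFamily k (u k) (v k) (a • v k) 0 = u k := by simp [modelFamily]
  rcases q with i | ⟨i, n⟩
  · simpa [quarticNormalForm, h0, mon] using hasLeading_u_pow_mul (hasLeading_mon (k := k) 0) i
  · simpa [quarticNormalForm, h0, add_comm] using
      hasLeading_u_pow_mul (hasLeading_modelFamily a (n + 1)) i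

theorem linearIndependent_quarticNormalForm (a : k) :
    LinearIndependent k (quarticNormalForm (modelFamily k (u k) (v k) (a • v k))) := by
  refine linearIndependent_of_hasLeading ?_ (hasLeading_quarticNormalForm a)
  rintro (i | ⟨i, n⟩) (i' | ⟨i', n'⟩) h <;> simp at h ⊢ <;> omega

theorem linearIndependent_cubicNormalForm [CharZero k] {a : k} (ha : a ^ 2 - a ≠ 0) :
    LinearIndependent k (cubicNormalForm k (modelFamily k (u k) (v k) (a • v k))) := by
  refine linearIndependent_of_hasLeading (b := monBasis k) (wt := toLex)
    (σ := Sum.elim (Sum.elim (fun i => (i, 0)) (fun q => (q.1 + 1, q.2 + 1)))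
      fun t => (0, t + 4)) ?_ ?_
  · rintro ((i | ⟨i, n⟩) | t) ((i' | ⟨i', n'⟩) | t') h <;> simp at h ⊢ <;> omega
  · rintro (q | t)
    · exact hasLeading_quarticNormalForm a q
    · simp only [cubicNormalForm, Sum.elim_inr, unitDefect_modelFamily_smul (rel_uv k)]
      simpa [mon] using (hasLeading_mon (0, t + 4)).smul ha

end JordanPlane

namespace UWittPos

variable (k : Type*) [Field k] [CharZero k]

theorem ker_phi : TwoSidedIdeal.ker (phi k) = TwoSidedIdeal.span {sextic (gen k)} := by
  refine ker_eq_span_of_linearIndependent (nf := sexticNormalForm (gen k)) ?_ ?_ fun x => ?_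
  · rintro _ rfl
    rw [map_sextic, phi_comp_gen]
    exact sextic_modelFamily (SAlg.rel_uv k) (SAlg.rel_uw k) (SAlg.rel_vw k)
  · rw [map_sexticNormalForm, phi_comp_gen]
    exact SAlg.linearIndependent_sexticNormalForm
  · set π := (TwoSidedIdeal.span {sextic (gen k)}).ringCon.mkₐ k
    have hπ : sextic (π ∘ gen k) = 0 := by
      rw [← map_sextic]
      exact (RingCon.eq _).mpr (TwoSidedIdeal.subset_span rfl)
    rw [map_sexticNormalForm]
    exact ((isWittFamily_gen k).comp π).mem_span_sexticNormalForm hπ (map_mem_adjoin π x)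

variable {k}

theorem ker_lam_of_sq_sub_eq_zero {a : k} (ha : a ^ 2 - a = 0) :
    TwoSidedIdeal.ker (lam a) = TwoSidedIdeal.span {quartic (gen k)} := by
  refine ker_eq_span_of_linearIndependent (nf := quarticNormalForm (gen k)) ?_ ?_ fun x => ?_
  · rintro _ rfl
    rw [map_quartic, lam_comp_gen]
    exact quartic_modelFamily_smul (JordanPlane.rel_uv k) ha
  · rw [map_quarticNormalForm, lam_comp_gen]
    exact JordanPlane.linearIndependent_quarticNormalForm a
  · set π := (TwoSidedIdeal.span {quartic (gen k)}).ringCon.mkₐ k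
    have hπ : quartic (π ∘ gen k) = 0 := by
      rw [← map_quartic]
      exact (RingCon.eq _).mpr (TwoSidedIdeal.subset_span rfl)
    rw [map_quarticNormalForm]
    exact ((isWittFamily_gen k).comp π).mem_span_quarticNormalForm hπ (map_mem_adjoin π x)

theorem h₃_eq (a : k) : h₃ a = -((4 : k) • (gen k 0 * h₁ a)) - (4 : k) • cubicRel (gen k) a 1 0
    - (16 * a + 8) • cubicRel (gen k) a 0 1 + ((20 * a ^ 2 + 14 * a - 3) / 3) • h₂ k := by
  rw [← cubicRel_gen, ← sextic_gen, ← (isWittFamily_gen k).cubic_generator_eq]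
  rfl

theorem ker_lam_of_sq_sub_ne_zero {a : k} (ha : a ^ 2 - a ≠ 0) :
    TwoSidedIdeal.ker (lam a) = TwoSidedIdeal.span {h₁ a, h₂ k, h₃ a} := by
  refine ker_eq_span_of_linearIndependent (nf := cubicNormalForm k (gen k)) ?_ ?_ fun x => ?_
  · have hc : ∀ n t, lam a (cubicRel (gen k) a n t) = 0 := fun n t => by
      rw [map_cubicRel, lam_comp_gen, cubicRel_modelFamily_smul (JordanPlane.rel_uv k)]
    have hs : lam a (h₂ k) = 0 := by
      rw [← sextic_gen, map_sextic, lam_comp_gen]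
      exact sextic_modelFamily (JordanPlane.rel_uv k) (smul_rel (JordanPlane.rel_uv k) a)
        (mul_smul_self_sub _ a)
    rintro _ (rfl | rfl | rfl)
    · rw [← cubicRel_gen, hc]
    · exact hs
    · rw [h₃_eq, ← cubicRel_gen]
      simp [hc, hs]
  · rw [map_cubicNormalForm, lam_comp_gen]
    exact JordanPlane.linearIndependent_cubicNormalForm ha
  · set π := (TwoSidedIdeal.span {h₁ a, h₂ k, h₃ a}).ringCon.mkₐ k
    have hπ : ∀ y ∈ ({h₁ a, h₂ k, h₃ a} : Set _), π y = 0 := fun y hy =>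
      (RingCon.eq _).mpr (TwoSidedIdeal.subset_span hy)
    have hE := (isWittFamily_gen k).comp π
    have hs : sextic (π ∘ gen k) = 0 := by
      rw [← map_sextic, sextic_gen, hπ _ (by simp)]
    have hc₀₀ : cubicRel (π ∘ gen k) a 0 0 = 0 := by
      rw [← map_cubicRel, cubicRel_gen, hπ _ (by simp)]
    have hc₀₁ : cubicRel (π ∘ gen k) a 0 1 = 0 := by
      simpa [hc₀₀] using (hE.comm_cubicRel hs a 0 0 0).symm
    have hc₁₀ : cubicRel (π ∘ gen k) a 1 0 = 0 := by
      have h := (congrArg π (h₃_eq a)).symm.trans (hπ _ (by simp))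
      simpa [map_cubicRel, hc₀₁, hπ (h₁ a), hπ (h₂ k)] using h
    rw [map_cubicNormalForm]
    exact hE.mem_span_cubicNormalForm hs (hE.cubicRel_eq_zero hs hc₀₀ hc₁₀) (map_mem_adjoin π x)

end UWittPos

/-! ### Subalgebras containing a left ideal -/

section KilledBy

variable {k : Type*} [Field k] {R : Type*} [Ring R] [Algebra k R]

variable (k) in
/-- The subspace of the elements of a module that are killed by a left ideal `T`. -/
def killedBy (T : Ideal R) (N : Type*) [AddCommGroup N] [Module R N] [Module k N]
    [IsScalarTower k R N] : Submodule k N where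
  carrier := {x | ∀ t ∈ T, t • x = 0}
  zero_mem' := fun t _ => smul_zero t
  add_mem' := fun hx hy t ht => by rw [smul_add, hx t ht, hy t ht, add_zero]
  smul_mem' := fun c x hx t ht => by
    rw [← algebraMap_smul R c x, smul_smul, ← Algebra.commutes, ← smul_smul, hx t ht, smul_zero]

variable {T : Ideal R} {N : Type*} [AddCommGroup N] [Module R N] [Module k N]
  [IsScalarTower k R N]

theorem fg_killedBy_of_forall_mem_sup {J : Ideal R} {V : Submodule k R} (hV : V.FG)
    (hJ : ∀ x, x ∈ V ⊔ J.restrictScalars k) : (killedBy k T (R ⧸ J)).FG := by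
  refine (hV.map (J.mkQ.restrictScalars k)).of_le fun x _ => ?_
  obtain ⟨x, rfl⟩ := J.mkQ_surjective x
  obtain ⟨y, hy, z, hz, rfl⟩ := Submodule.mem_sup.mp (hJ x)
  exact ⟨y, hy, by simpa using hz⟩

theorem fg_killedBy_inf_span_singleton (hT : ∀ J : Ideal R, T ≤ J → (killedBy k T (R ⧸ J)).FG)
    {y : N} (hy : y ∈ killedBy k T N) :
    (killedBy k T N ⊓ (Submodule.span R {y}).restrictScalars k).FG := by
  let g := LinearMap.toSpanSingleton R N y
  let f : R ⧸ LinearMap.ker g →ₗ[R] N := (LinearMap.ker g).liftQ g le_rfl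
  have hf : ∀ x, f x = 0 → x = 0 := fun x hx =>
    (Submodule.mem_bot R).mp ((LinearMap.ker g).ker_liftQ_eq_bot g le_rfl le_rfl ▸ hx)
  refine ((hT (LinearMap.ker g) hy).map (f.restrictScalars k)).of_le ?_
  rintro _ ⟨hx, hxy⟩
  obtain ⟨r, rfl⟩ := Submodule.mem_span_singleton.mp hxy
  exact ⟨Submodule.Quotient.mk r, fun t ht => hf _ ((map_smul f t _).trans (hx t ht)), rfl⟩

theorem fg_killedBy_inf_span (hT : ∀ J : Ideal R, T ≤ J → (killedBy k T (R ⧸ J)).FG) {s : Set N}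
    (hs : s.Finite) (hkill : ∀ y ∈ s, y ∈ killedBy k T N) :
    (killedBy k T N ⊓ (Submodule.span R s).restrictScalars k).FG := by
  induction s, hs using Set.Finite.induction_on with
  | empty => simpa using Submodule.fg_bot
  | @insert y s _ _ ih =>
    set M := Submodule.span R s
    have hmk : ∀ x ∈ killedBy k T N, M.mkQ x ∈ killedBy k T (N ⧸ M) := fun x hx t ht => by
      rw [← map_smul, hx t ht, map_zero]
    refine Submodule.fg_of_fg_map_of_fg_inf_ker (M.mkQ.restrictScalars k)
      ((fg_killedBy_inf_span_singleton hT (hmk y (hkill y (Set.mem_insert y s)))).of_le ?_)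
      ((ih fun y hy => hkill y (Set.mem_insert_of_mem _ hy)).of_le ?_)
    · rintro _ ⟨x, ⟨hx, hxs⟩, rfl⟩
      obtain ⟨r, z, hz, rfl⟩ := Submodule.mem_span_insert.mp hxs
      refine ⟨hmk _ hx, Submodule.mem_span_singleton.mpr ⟨r, ?_⟩⟩
      simpa using hz
    · rintro x ⟨⟨hx, -⟩, hxM⟩
      exact ⟨hx, (Submodule.Quotient.mk_eq_zero M).mp hxM⟩

theorem fg_map_of_mul_mem_ker [IsNoetherianRing R] {M : Type*} [AddCommGroup M] [Module k M]
    (hT : ∀ J : Ideal R, T ≤ J → (killedBy k T (R ⧸ J)).FG) {I : Submodule k R} {g : R →ₗ[k] M}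
    {J : Ideal R} (hJ : ∀ t ∈ T, ∀ x ∈ I, t * x ∈ J)
    (hg : J.restrictScalars k ≤ LinearMap.ker g) : (I.map g).FG := by
  obtain ⟨Y, hYI, hY⟩ := (Submodule.fg_span_iff_fg_span_finset_subset (R := R) (I : Set R)).mp
    (IsNoetherian.noetherian _)
  have hkill : ∀ x ∈ I, J.mkQ x ∈ killedBy k T (R ⧸ J) := fun x hx t ht => by
    rw [← map_smul]
    exact (Submodule.Quotient.mk_eq_zero J).mpr (hJ t ht x hx)
  have hfg : (I.map (J.mkQ.restrictScalars k)).FG := by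
    refine (fg_killedBy_inf_span (s := J.mkQ '' Y) hT (Y.finite_toSet.image _) ?_).of_le ?_
    · rintro _ ⟨y, hy, rfl⟩
      exact hkill y (hYI hy)
    · rintro _ ⟨x, hx, rfl⟩
      refine ⟨hkill x hx, ?_⟩
      rw [← Submodule.map_span, ← hY]
      exact Submodule.mem_map_of_mem (Submodule.subset_span hx)
  have hcomp : g = ((J.restrictScalars k).liftQ g hg ∘ₗ
      (Submodule.Quotient.restrictScalarsEquiv k J).symm.toLinearMap) ∘ₗ
        J.mkQ.restrictScalars k := rfl
  rw [hcomp, Submodule.map_comp]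
  exact hfg.map _

variable {B : Subalgebra k R}

theorem exists_fg_le_mul_mem [IsNoetherianRing R] (hTB : ∀ t ∈ T, t ∈ B) (I : Submodule B R) :
    ∃ X ≤ I, X.FG ∧
      ∀ z ∈ Submodule.span R {z | ∃ t ∈ T, ∃ x ∈ I, t * x = z}, z ∈ X := by
  obtain ⟨G, hGs, hG⟩ := (Submodule.fg_span_iff_fg_span_finset_subset (R := R)
    {z | ∃ t ∈ T, ∃ x ∈ I, t * x = z}).mp (IsNoetherian.noetherian _)
  have hGs' : ∀ z ∈ G, ∃ t ∈ T, ∃ x ∈ I, t * x = z := fun z hz => hGs hz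
  choose! t ht x hx htx using hGs'
  refine ⟨Submodule.span B (x '' G), Submodule.span_le.mpr ?_,
    Submodule.fg_span (G.finite_toSet.image x), fun z hz => ?_⟩
  · rintro _ ⟨y, hy, rfl⟩
    exact hx y hy
  · obtain ⟨c, -, rfl⟩ := Submodule.mem_span_finset.mp (hG ▸ hz)
    refine Submodule.sum_mem _ fun y hy => ?_
    have hct : c y * t y ∈ B := hTB _ (T.mul_mem_left _ (ht y hy))
    have hcy : c y • y = (⟨c y * t y, hct⟩ : B) • x y := by
      rw [Subalgebra.smul_def, smul_eq_mul, smul_eq_mul, mul_assoc, htx y hy]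
    exact hcy ▸ Submodule.smul_mem _ _ (Submodule.subset_span (Set.mem_image_of_mem x hy))

/-- For a left ideal `I` of the subalgebra, `T * I` lies in a finitely generated part of `I`, and
modulo the left ideal of `R` generated by `T * I` the elements of `I` are killed by `T`. -/
theorem isNoetherianRing_of_leftIdeal_le [IsNoetherianRing R] (hTB : ∀ t ∈ T, t ∈ B)
    (hT : ∀ J : Ideal R, T ≤ J → (killedBy k T (R ⧸ J)).FG) : IsNoetherianRing B := by
  suffices IsNoetherian B R from
    isNoetherian_of_injective (LinearMap.toSpanSingleton B R 1) fun x y hxy =>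
      Subtype.ext (by simpa [Subalgebra.smul_def] using hxy)
  refine ⟨fun I => ?_⟩
  obtain ⟨X, hXI, hX, hTX⟩ := exists_fg_le_mul_mem hTB I
  refine Submodule.fg_of_fg_map_of_fg_inf_ker X.mkQ ?_ ?_
  · refine Submodule.FG.of_restrictScalars k ?_
    exact fg_map_of_mul_mem_ker (I := I.restrictScalars k) (g := X.mkQ.restrictScalars k)
      (J := Ideal.span {z | ∃ t ∈ T, ∃ x ∈ I, t * x = z}) hT
      (fun t ht x hx => Submodule.subset_span ⟨t, ht, x, hx, rfl⟩)
      fun z hz => (Submodule.Quotient.mk_eq_zero X).mpr (hTX z hz)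
  · rwa [Submodule.ker_mkQ, inf_eq_right.mpr hXI]

end KilledBy

theorem isNoetherianRing_range_of_ker_le {k A B C : Type*} [CommRing k] [Ring A] [Ring B] [Ring C]
    [Algebra k A] [Algebra k B] [Algebra k C] {f : A →ₐ[k] B} {g : A →ₐ[k] C}
    (h : ∀ x, f x = 0 → g x = 0) [IsNoetherianRing f.range] : IsNoetherianRing g.range := by
  have hs : Function.Surjective f.rangeRestrict.toRingHom := f.rangeRestrict_surjective
  have hker : RingHom.ker f.rangeRestrict.toRingHom ≤ RingHom.ker g.rangeRestrict.toRingHom :=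
    fun x hx => Subtype.ext (h x (congrArg Subtype.val hx))
  refine isNoetherianRing_of_surjective _ _ (RingHom.liftOfSurjective _ hs ⟨_, hker⟩) fun y => ?_
  obtain ⟨x, rfl⟩ := g.rangeRestrict_surjective y
  exact ⟨f.rangeRestrict x,
    RingHom.liftOfRightInverse_comp_apply _ _ (Function.rightInverse_surjInv hs) ⟨_, hker⟩ x⟩

/-! ### The images of the `λ_a` -/

namespace JordanPlane

variable (k : Type*) [Field k]

theorem isNoetherianRing : IsNoetherianRing (JordanPlane k) := by
  refine isNoetherianRing_of_hasLeading (b := monBasis k) (wt := toLex) toLex.injective ?_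
  rintro μ ν hμν
  obtain ⟨⟨p, q⟩, rfl⟩ := exists_add_of_le hμν
  refine ⟨v k ^ q * u k ^ p, fun x hx => ?_⟩
  rw [mul_assoc]
  simpa [add_assoc] using hasLeading_v_pow_mul (hasLeading_u_pow_mul hx p) q

/-- The left ideal `R_{≥ n}`. -/
noncomputable def idealGE (n : ℕ) : Ideal (JordanPlane k) where
  __ := gradedPartGE k n
  smul_mem' := fun r x hx => by
    refine mul_mem_of_mem_adjoin (s := {u k, v k}) (fun g hg x hx => ?_)
      (adjoin_eq_top k ▸ Algebra.mem_top) hx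
    suffices h : gradedPartGE k n ≤ (gradedPartGE k n).comap (LinearMap.mulLeft k g) from h hx
    refine iSup₂_le fun m hm x hx => ?_
    refine le_iSup₂_of_le (f := fun m (_ : m ≥ n) => gradedPart k m) (m + 1)
      (Nat.le_succ_of_le hm) le_rfl ?_
    rw [gradedPart, pow_succ']
    exact Submodule.mul_mem_mul (Submodule.subset_span hg) hx

variable {k}

theorem mon_mem_idealGE {n : ℕ} {p : ℕ × ℕ} (h : n ≤ p.1 + p.2) : mon k p ∈ idealGE k n := by
  have hp : mon k p ∈ gradedPart k (p.1 + p.2) := by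
    rw [gradedPart, add_comm, pow_add]
    exact Submodule.mul_mem_mul (Submodule.pow_mem_pow _ (Submodule.subset_span (by simp)) _)
      (Submodule.pow_mem_pow _ (Submodule.subset_span (by simp)) _)
  exact le_iSup₂_of_le (f := fun m (_ : m ≥ n) => gradedPart k m) (p.1 + p.2) h le_rfl hp

theorem fg_killedBy_idealGE {n : ℕ} {J : Ideal (JordanPlane k)} (hJ : idealGE k n ≤ J) :
    (killedBy k (idealGE k n) (JordanPlane k ⧸ J)).FG := by
  let s : Finset (ℕ × ℕ) := Finset.range n ×ˢ Finset.range n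
  refine fg_killedBy_of_forall_mem_sup
    (Submodule.fg_span (s.finite_toSet.image (mon k))) fun x => ?_
  refine Submodule.span_le.mpr ?_ (span_mon k ▸ Submodule.mem_top (x := x))
  rintro _ ⟨p, rfl⟩
  by_cases h : n ≤ p.1 + p.2
  · exact Submodule.mem_sup_right (hJ (mon_mem_idealGE h))
  · exact Submodule.mem_sup_left (Submodule.subset_span ⟨p, by simp [s]; omega, rfl⟩)

section Polynomial

open Polynomial

theorem u_mul_aeval_v (q : k[X]) :
    u k * aeval (v k) q = aeval (v k) q * u k + aeval (v k) (X ^ 2 * derivative q) := by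
  induction q using Polynomial.induction_on' with
  | add p q hp hq => simp only [map_add, mul_add, add_mul, hp, hq]; abel
  | monomial n c =>
    rcases n with _ | n
    · simp [← Algebra.commutes c]
    have h := WittPos.pow_mul_comm_aux (k := k) (rel_uv k) (n + 1)
    rw [derivative_monomial, X_pow_mul_monomial, Nat.add_sub_cancel, aeval_monomial,
      aeval_monomial, ← Algebra.smul_def, ← Algebra.smul_def, mul_smul_comm, smul_mul_assoc, h,
      smul_sub, smul_smul, sub_add_cancel]

theorem exists_sub_aeval_v_mem (x : JordanPlane k) :
    ∃ q : k[X], x - aeval (v k) q ∈ Ideal.span {u k} := by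
  suffices h : x ∈ Subalgebra.toSubmodule (aeval (v k)).range ⊔
      (Ideal.span {u k}).restrictScalars k by
    obtain ⟨_, ⟨q, rfl⟩, z, hz, rfl⟩ := Submodule.mem_sup.mp h
    exact ⟨q, by simpa using hz⟩
  refine Submodule.span_le.mpr ?_ (span_mon k ▸ Submodule.mem_top (x := x))
  rintro _ ⟨⟨_ | i, j⟩, rfl⟩
  · exact Submodule.mem_sup_left ⟨X ^ j, by simp [mon]⟩
  · refine Submodule.mem_sup_right (Ideal.mem_span_singleton'.mpr ⟨v k ^ j * u k ^ i, ?_⟩)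
    rw [mon, pow_succ, mul_assoc]

theorem fg_killedBy_of_aeval_v_mem {J T : Ideal (JordanPlane k)} (hJ : Ideal.span {u k} ≤ J)
    {p : k[X]} (hp0 : p ≠ 0) (hp : aeval (v k) p ∈ J) :
    (killedBy k T (JordanPlane k ⧸ J)).FG := by
  have hfg : (degreeLT k p.natDegree).FG := by
    classical exact ⟨_, degreeLT_eq_span_X_pow.symm⟩
  refine fg_killedBy_of_forall_mem_sup (hfg.map (aeval (v k)).toLinearMap) fun x => ?_
  obtain ⟨q, hq⟩ := exists_sub_aeval_v_mem x
  have hdiv : aeval (v k) q - aeval (v k) (q % p) ∈ J := by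
    rw [← map_sub, EuclideanDomain.mod_eq_sub_mul_div, sub_sub_cancel, mul_comm, map_mul]
    exact J.mul_mem_left _ hp
  refine Submodule.mem_sup.mpr ⟨aeval (v k) (q % p), ⟨q % p, ?_, rfl⟩,
    x - aeval (v k) (q % p), ?_, add_sub_cancel _ _⟩
  · rw [SetLike.mem_coe, mem_degreeLT, ← degree_eq_natDegree hp0]
    exact degree_mod_lt q hp0
  · rw [← sub_add_sub_cancel x (aeval (v k) q)]
    exact add_mem (hJ hq) hdiv

theorem killedBy_span_u_le [CharZero k] {J : Ideal (JordanPlane k)} (hJ : Ideal.span {u k} ≤ J)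
    (h : ∀ p : k[X], aeval (v k) p ∈ J → p = 0) :
    killedBy k (Ideal.span {u k}) (JordanPlane k ⧸ J) ≤ Submodule.span k {J.mkQ 1} := by
  intro x hx
  obtain ⟨x, rfl⟩ := J.mkQ_surjective x
  obtain ⟨q, hq⟩ := exists_sub_aeval_v_mem x
  have hux : u k * x ∈ J :=
    (Submodule.Quotient.mk_eq_zero J).mp (hx _ (Ideal.mem_span_singleton_self _))
  have hder : aeval (v k) (X ^ 2 * derivative q) ∈ J := by
    have hsub := sub_mem hux (J.mul_mem_left (u k) (hJ hq))
    rw [mul_sub, sub_sub_cancel, u_mul_aeval_v] at hsub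
    exact (J.add_mem_iff_right (J.mul_mem_left _ (hJ (Ideal.mem_span_singleton_self _)))).mp hsub
  have hq' : derivative q = 0 :=
    (mul_eq_zero.mp (h _ hder)).resolve_left (pow_ne_zero 2 X_ne_zero)
  obtain ⟨c, rfl⟩ := natDegree_eq_zero.mp (derivative_eq_zero.mp hq')
  refine Submodule.mem_span_singleton.mpr ⟨c, ?_⟩
  rw [aeval_C, Algebra.algebraMap_eq_smul_one] at hq
  exact ((Submodule.Quotient.eq J).mpr (hJ hq)).symm

theorem fg_killedBy_span_u [CharZero k] {J : Ideal (JordanPlane k)} (hJ : Ideal.span {u k} ≤ J) :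
    (killedBy k (Ideal.span {u k}) (JordanPlane k ⧸ J)).FG := by
  by_cases h : ∃ p : k[X], p ≠ 0 ∧ aeval (v k) p ∈ J
  · obtain ⟨p, hp0, hp⟩ := h
    exact fg_killedBy_of_aeval_v_mem hJ hp0 hp
  · push Not at h
    exact (Submodule.fg_span_singleton _).of_le
      (killedBy_span_u_le hJ fun p => not_imp_not.mp (h p))

end Polynomial

end JordanPlane

theorem modelFamily_op_neg {k A : Type*} [Field k] [Ring A] [Algebra k A] {u v : A}
    (h₁ : u * v - v * u - v ^ 2 = 0) (a : k) :
    modelFamily k (MulOpposite.op (-u)) (MulOpposite.op v) ((1 - a) • MulOpposite.op v) =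
      fun i => -MulOpposite.op (modelFamily k u v (a • v) i) := by
  ext i
  apply MulOpposite.unop_injective
  simp only [modelFamily, MulOpposite.unop_mul, MulOpposite.unop_sub, MulOpposite.unop_smul,
    MulOpposite.unop_neg, MulOpposite.unop_op, MulOpposite.unop_pow, mul_neg, sub_mul,
    WittPos.pow_mul_comm_aux (k := k) h₁, smul_mul_assoc, ← pow_succ']
  module

namespace JordanPlane

variable (k : Type*) [Field k]

/-- The algebra map `R → Rᵐᵒᵖ` that sends `u` to `-u` and `v` to `v`. It exchanges, up to sign, the
values of `λ_a` and `λ_{1 - a}` on the generators, and so exchanges left and right. -/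
noncomputable def opNegHom : JordanPlane k →ₐ[k] (JordanPlane k)ᵐᵒᵖ :=
  lift (MulOpposite.op (-u k)) (MulOpposite.op (v k)) <| by
    simp only [← MulOpposite.op_mul, ← MulOpposite.op_pow, ← MulOpposite.op_sub]
    rw [MulOpposite.op_eq_zero_iff, ← rel_uv k]
    noncomm_ring

variable {k}

theorem gradedPart_le_span_mon (n : ℕ) :
    gradedPart k n ≤ Submodule.span k (mon k '' {p | p.1 + p.2 = n}) := by
  induction n with
  | zero =>
    rw [gradedPart, pow_zero, Submodule.one_le]
    exact Submodule.subset_span ⟨0, rfl, by simp [mon]⟩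
  | succ n ih =>
    rw [gradedPart, pow_succ', ← gradedPart]
    refine (mul_le_mul' le_rfl ih).trans ?_
    rw [Submodule.span_mul_span, Submodule.span_le]
    have mem : ∀ p : ℕ × ℕ, p.1 + p.2 = n + 1 →
        mon k p ∈ Submodule.span k (mon k '' {p | p.1 + p.2 = n + 1}) :=
      fun p hp => Submodule.subset_span ⟨p, hp, rfl⟩
    rintro _ ⟨g, rfl | rfl, _, ⟨p, rfl, rfl⟩, rfl⟩
    · beta_reduce
      rw [u_mul_mon]
      exact add_mem (mem _ (by simp; omega)) (Submodule.smul_mem _ _ (mem _ (by simp; omega)))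
    · beta_reduce
      rw [v_mul_mon]
      exact mem _ (by simp; omega)

end JordanPlane

namespace UWittPos

open JordanPlane

variable (k : Type*) [Field k]

theorem lam_gen (a : k) (i : ℕ) :
    lam a (gen k i) = modelFamily k (u k) (v k) (a • v k) i :=
  congrFun (lam_comp_gen a) i

variable {k} in
theorem lam_gen_mul_gen_zero_pow (a : k) (i j : ℕ) :
    lam a (gen k j * gen k 0 ^ i) =
      mon k (i + 1, j) + ((j : k) * (1 - a)) • mon k (i, j + 1) := by
  have h0 : lam a (gen k 0) = u k := by simp [lam_gen, modelFamily]
  rw [map_mul, map_pow, h0, lam_gen, modelFamily_mul_u_pow]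

variable {k} in
theorem opNegHom_comp_lam_comp_gen (a : k) :
    (opNegHom k).comp (lam (1 - a)) ∘ gen k = fun i => -MulOpposite.op (lam a (gen k i)) := by
  rw [AlgHom.coe_comp, Function.comp_assoc, lam_comp_gen, map_modelFamily, opNegHom, map_smul,
    lift_u, lift_v, modelFamily_op_neg (rel_uv k)]
  simp only [lam_gen]

theorem range_lam_zero : ((lam (0 : k)).range : Set (JordanPlane k)) =
    {x | ∃ (c : k) (r : JordanPlane k), x = algebraMap k (JordanPlane k) c + u k * r} := by
  ext x
  constructor
  · rintro ⟨y, rfl⟩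
    let N := Submodule.span k {1} ⊔ LinearMap.range (LinearMap.mulLeft k (u k))
    have hN : lam (0 : k) y ∈ N := by
      refine mem_of_mem_adjoin (Submodule.mem_sup_left (Submodule.mem_span_singleton_self 1))
        ?_ (map_mem_adjoin _ y)
      rintro _ ⟨i, rfl⟩ z -
      exact Submodule.mem_sup_right ⟨v k ^ i * z, by simp [lam_gen, modelFamily, mul_assoc]⟩
    obtain ⟨_, hc, _, ⟨r, rfl⟩, h⟩ := Submodule.mem_sup.mp hN
    obtain ⟨c, rfl⟩ := Submodule.mem_span_singleton.mp hc
    exact ⟨c, r, by rw [Algebra.algebraMap_eq_smul_one]; exact h.symm⟩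
  · rintro ⟨c, r, rfl⟩
    refine add_mem (Subalgebra.algebraMap_mem _ c) (mul_mem_span_range (f := mon k)
      (N := Subalgebra.toSubmodule (lam 0).range) (fun p => ?_) (span_mon k ▸ Submodule.mem_top))
    refine ⟨gen k p.2 * gen k 0 ^ p.1, (lam_gen_mul_gen_zero_pow _ _ _).trans ?_⟩
    rw [u_mul_mon, sub_zero, mul_one]
    rfl

theorem range_lam_one : ((lam (1 : k)).range : Set (JordanPlane k)) =
    {x | ∃ (c : k) (r : JordanPlane k), x = algebraMap k (JordanPlane k) c + r * u k} := by
  ext x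
  constructor
  · rintro ⟨y, rfl⟩
    let N := Submodule.span k {1} ⊔ LinearMap.range (LinearMap.mulRight k (u k))
    have hN : lam (1 : k) y ∈ N := by
      refine mem_of_mem_adjoin_right (Submodule.mem_sup_left (Submodule.mem_span_singleton_self 1))
        ?_ (map_mem_adjoin _ y)
      rintro _ ⟨i, rfl⟩ z -
      have hi : lam (1 : k) (gen k i) = v k ^ i * u k := by
        simpa [mon] using lam_gen_mul_gen_zero_pow (1 : k) 0 i
      exact Submodule.mem_sup_right ⟨z * v k ^ i, by simp [hi, mul_assoc]⟩
    obtain ⟨_, hc, _, ⟨r, rfl⟩, h⟩ := Submodule.mem_sup.mp hN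
    obtain ⟨c, rfl⟩ := Submodule.mem_span_singleton.mp hc
    exact ⟨c, r, by rw [Algebra.algebraMap_eq_smul_one]; exact h.symm⟩
  · rintro ⟨c, r, rfl⟩
    refine add_mem (Subalgebra.algebraMap_mem _ c) (mul_mem_span_range_right (f := mon k)
      (N := Subalgebra.toSubmodule (lam 1).range) (fun p => ?_) (span_mon k ▸ Submodule.mem_top))
    refine ⟨gen k p.2 * gen k 0 ^ p.1, (lam_gen_mul_gen_zero_pow _ _ _).trans ?_⟩
    simp [mon, pow_succ, mul_assoc]

variable {k} [CharZero k]

theorem gradedPartGE_le_range {a : k} (ha : a ^ 2 - a ≠ 0) :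
    gradedPartGE k 4 ≤ Subalgebra.toSubmodule (lam a).range := by
  have mem : ∀ i j, 4 ≤ i + j → mon k (i, j) ∈ (lam a).range := by
    intro i
    induction i with
    | zero =>
      intro j hj
      obtain ⟨t, rfl⟩ : ∃ t, j = t + 4 := ⟨j - 4, by omega⟩
      have h : lam a (unitDefect k (gen k) t) = (a ^ 2 - a) • mon k (0, t + 4) := by
        rw [map_unitDefect, lam_comp_gen, unitDefect_modelFamily_smul (rel_uv k)]
        simp [mon]
      rw [← inv_smul_smul₀ ha (mon k (0, t + 4)), ← h]
      exact Subalgebra.smul_mem _ (AlgHom.mem_range_self _ _) _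
    | succ i ih =>
      intro j hj
      rw [eq_sub_of_add_eq (lam_gen_mul_gen_zero_pow a i j).symm]
      exact sub_mem ⟨_, rfl⟩ (Subalgebra.smul_mem _ (ih (j + 1) (by omega)) _)
  refine iSup₂_le fun n hn => (gradedPart_le_span_mon n).trans (Submodule.span_le.mpr ?_)
  rintro _ ⟨p, rfl, rfl⟩
  exact mem p.1 p.2 hn

theorem isNoetherianRing_range_lam_one : IsNoetherianRing (lam (1 : k)).range := by
  have := JordanPlane.isNoetherianRing k
  refine isNoetherianRing_of_leftIdeal_le (T := Ideal.span {u k}) (fun t ht => ?_)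
    fun J => fg_killedBy_span_u
  obtain ⟨r, rfl⟩ := Ideal.mem_span_singleton'.mp ht
  rw [← SetLike.mem_coe, range_lam_one]
  exact ⟨0, r, by simp⟩

theorem isNoetherianRing_range_lam (a : k) : IsNoetherianRing (lam a).range := by
  by_cases ha : a ^ 2 - a = 0
  · have := isNoetherianRing_range_lam_one (k := k)
    have hker : TwoSidedIdeal.ker (lam (1 : k)) = TwoSidedIdeal.ker (lam a) := by
      rw [ker_lam_of_sq_sub_eq_zero ha, ker_lam_of_sq_sub_eq_zero (by ring)]
    exact isNoetherianRing_range_of_ker_le fun x hx => (TwoSidedIdeal.mem_ker _).mp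
      (hker ▸ (TwoSidedIdeal.mem_ker _).mpr hx)
  · have := JordanPlane.isNoetherianRing k
    exact isNoetherianRing_of_leftIdeal_le (T := idealGE k 4)
      (fun t ht => gradedPartGE_le_range ha ht) fun J => fg_killedBy_idealGE

theorem isNoetherianRing_range_lam_op (a : k) : IsNoetherianRing ((lam a).range)ᵐᵒᵖ := by
  let g := (opNegHom k).comp (lam (1 - a))
  have hg : g.range = (lam a).range.op := by
    rw [range_eq_adjoin, range_eq_adjoin, Subalgebra.op_adjoin]
    have hgen : ∀ i, g (gen k i) = -MulOpposite.op (lam a (gen k i)) :=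
      congrFun (opNegHom_comp_lam_comp_gen a)
    refine le_antisymm (Algebra.adjoin_le ?_) (Algebra.adjoin_le ?_)
    · rintro _ ⟨i, rfl⟩
      rw [SetLike.mem_coe, Function.comp_apply, hgen]
      exact neg_mem (Algebra.subset_adjoin ⟨i, rfl⟩)
    · rintro x ⟨i, hi⟩
      have hx : x = -g (gen k i) := by
        rw [hgen, neg_neg]
        exact MulOpposite.unop_injective hi.symm
      rw [hx]
      exact neg_mem (Algebra.subset_adjoin ⟨i, rfl⟩)
  have := isNoetherianRing_range_lam (1 - a)
  have hop : IsNoetherianRing (lam a).range.op := by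
    rw [← hg]
    exact isNoetherianRing_range_of_ker_le (f := lam (1 - a)) fun x hx => by simp [g, hx]
  exact isNoetherianRing_of_ringEquiv _
    ((RingEquiv.opOp _).trans (RingEquiv.op (lam a).range.algEquivOpMop.toRingEquiv.symm))

end UWittPos

/-! ### Homogeneity -/

namespace UWittPos

variable (k : Type*) [Field k]

theorem e_mem_gradedPart (n : ℕ+) : e k n ∈ gradedPart k n :=
  Submodule.subset_span ⟨[n], by simp, by simp⟩

instance : SetLike.GradedMonoid (gradedPart k) where
  one_mem := Submodule.subset_span ⟨[], rfl, rfl⟩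
  mul_mem i j x y hx hy := by
    have hle : gradedPart k i * gradedPart k j ≤ gradedPart k (i + j) := by
      simp only [gradedPart]
      rw [Submodule.span_mul_span]
      refine Submodule.span_mono ?_
      rintro _ ⟨_, ⟨l, rfl, rfl⟩, _, ⟨m, rfl, rfl⟩, rfl⟩
      exact ⟨l ++ m, by simp, by simp⟩
    exact hle (Submodule.mul_mem_mul hx hy)

variable {k}

theorem mul_mem_gradedPart {x y : UWittPos k} {i j d : ℕ} (hx : x ∈ gradedPart k i)
    (hy : y ∈ gradedPart k j) (h : i + j = d) : x * y ∈ gradedPart k d :=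
  h ▸ SetLike.mul_mem_graded hx hy

theorem pow_mem_gradedPart {x : UWittPos k} {i d : ℕ} (n : ℕ) (hx : x ∈ gradedPart k i)
    (h : n * i = d) : x ^ n ∈ gradedPart k d :=
  h ▸ SetLike.pow_mem_graded n hx

theorem h₁_mem_gradedPart (a : k) : h₁ a ∈ gradedPart k 5 := by
  have he := e_mem_gradedPart k
  have e₁e₂e₂ : e k 1 * e k 2 ^ 2 ∈ gradedPart k 5 :=
    mul_mem_gradedPart (he 1) (pow_mem_gradedPart 2 (he 2) rfl) rfl
  have e₁e₁e₃ : e k 1 ^ 2 * e k 3 ∈ gradedPart k 5 :=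
    mul_mem_gradedPart (pow_mem_gradedPart 2 (he 1) rfl) (he 3) rfl
  have e₂e₃ : e k 2 * e k 3 ∈ gradedPart k 5 := mul_mem_gradedPart (he 2) (he 3) rfl
  have e₁e₄ : e k 1 * e k 4 ∈ gradedPart k 5 := mul_mem_gradedPart (he 1) (he 4) rfl
  exact sub_mem (add_mem (sub_mem (sub_mem e₁e₂e₂ e₁e₁e₃) (Submodule.smul_mem _ _ e₂e₃))
    (Submodule.smul_mem _ _ e₁e₄)) (Submodule.smul_mem _ _ (he 5))

variable (k) in
theorem h₂_mem_gradedPart : h₂ k ∈ gradedPart k 6 := by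
  have he := e_mem_gradedPart k
  have e₁e₅ : e k 1 * e k 5 ∈ gradedPart k 6 := mul_mem_gradedPart (he 1) (he 5) rfl
  have e₂e₄ : e k 2 * e k 4 ∈ gradedPart k 6 := mul_mem_gradedPart (he 2) (he 4) rfl
  have e₃e₃ : e k 3 ^ 2 ∈ gradedPart k 6 := pow_mem_gradedPart 2 (he 3) rfl
  simp only [h₂, ofNat_mul_eq_smul (k := k)]
  exact add_mem (add_mem (sub_mem e₁e₅ (Submodule.smul_mem _ _ e₂e₄))
    (Submodule.smul_mem _ _ e₃e₃)) (Submodule.smul_mem _ _ (he 6))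

theorem h₃_mem_gradedPart (a : k) : h₃ a ∈ gradedPart k 6 := by
  have he := e_mem_gradedPart k
  have e₁e₁e₂e₂ : e k 1 ^ 2 * e k 2 ^ 2 ∈ gradedPart k 6 :=
    mul_mem_gradedPart (pow_mem_gradedPart 2 (he 1) rfl) (pow_mem_gradedPart 2 (he 2) rfl) rfl
  have e₂e₂e₂ : e k 2 ^ 3 ∈ gradedPart k 6 := pow_mem_gradedPart 3 (he 2) rfl
  have e₁e₁e₁e₃ : e k 1 ^ 3 * e k 3 ∈ gradedPart k 6 :=
    mul_mem_gradedPart (pow_mem_gradedPart 3 (he 1) rfl) (he 3) rfl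
  have e₃e₃ : e k 3 ^ 2 ∈ gradedPart k 6 := pow_mem_gradedPart 2 (he 3) rfl
  have e₁e₅ : e k 1 * e k 5 ∈ gradedPart k 6 := mul_mem_gradedPart (he 1) (he 5) rfl
  simp only [h₃, ofNat_mul_eq_smul (k := k)]
  exact add_mem (sub_mem (add_mem (add_mem (sub_mem
    (neg_mem (Submodule.smul_mem _ _ e₁e₁e₂e₂)) (Submodule.smul_mem _ _ e₂e₂e₂))
    (Submodule.smul_mem _ _ e₁e₁e₁e₃)) (Submodule.smul_mem _ _ e₃e₃))
    (Submodule.smul_mem _ _ e₁e₅)) (Submodule.smul_mem _ _ (he 6))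

end UWittPos

theorem theorem0p4 (k : Type*) [Field k] [CharZero k] :
    -- (a) the kernel of `λ_a`
    (∀ a : k, a = 0 ∨ a = 1 →
      TwoSidedIdeal.ker (UWittPos.lam a) =
        TwoSidedIdeal.span
          {UWittPos.e k 1 * UWittPos.e k 3 - UWittPos.e k 2 ^ 2 - UWittPos.e k 4}) ∧
    (∀ a : k, a ≠ 0 → a ≠ 1 →
      UWittPos.h₁ a ∈ UWittPos.gradedPart k 5 ∧
      UWittPos.h₂ k ∈ UWittPos.gradedPart k 6 ∧
      UWittPos.h₃ a ∈ UWittPos.gradedPart k 6 ∧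
      TwoSidedIdeal.ker (UWittPos.lam a) =
        TwoSidedIdeal.span {UWittPos.h₁ a, UWittPos.h₂ k, UWittPos.h₃ a}) ∧
    -- (b) the image of `λ_a`
    (((UWittPos.lam (0 : k)).range : Set (JordanPlane k)) =
      {x | ∃ (c : k) (r : JordanPlane k),
        x = algebraMap k (JordanPlane k) c + JordanPlane.u k * r}) ∧
    (((UWittPos.lam (1 : k)).range : Set (JordanPlane k)) =
      {x | ∃ (c : k) (r : JordanPlane k),
        x = algebraMap k (JordanPlane k) c + r * JordanPlane.u k}) ∧
    (∀ a : k, a ≠ 0 → a ≠ 1 →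
      JordanPlane.gradedPartGE k 4 ≤ Subalgebra.toSubmodule (UWittPos.lam a).range) ∧
    (∀ a : k, IsNoetherianRing (UWittPos.lam a).range ∧
      IsNoetherianRing ((UWittPos.lam a).range)ᵐᵒᵖ) ∧
    -- (c) the kernel of `φ`
    TwoSidedIdeal.ker (UWittPos.phi k) =
      TwoSidedIdeal.span
        {UWittPos.e k 1 * UWittPos.e k 5 - 4 * (UWittPos.e k 2 * UWittPos.e k 4)
          + 3 * UWittPos.e k 3 ^ 2 + 2 * UWittPos.e k 6} := by
  have sq_sub_ne_zero {a : k} (h0 : a ≠ 0) (h1 : a ≠ 1) : a ^ 2 - a ≠ 0 := by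
    rw [sq, ← mul_sub_one]
    exact mul_ne_zero h0 (sub_ne_zero.mpr h1)
  have sq_sub_eq_zero {a : k} (ha : a = 0 ∨ a = 1) : a ^ 2 - a = 0 := by
    rcases ha with rfl | rfl <;> ring
  exact ⟨fun a ha => UWittPos.ker_lam_of_sq_sub_eq_zero (sq_sub_eq_zero ha),
    fun a h0 h1 => ⟨UWittPos.h₁_mem_gradedPart a, UWittPos.h₂_mem_gradedPart k,
      UWittPos.h₃_mem_gradedPart a, UWittPos.ker_lam_of_sq_sub_ne_zero (sq_sub_ne_zero h0 h1)⟩,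
    UWittPos.range_lam_zero k, UWittPos.range_lam_one k,
    fun a h0 h1 => UWittPos.gradedPartGE_le_range (sq_sub_ne_zero h0 h1),
    fun a => ⟨UWittPos.isNoetherianRing_range_lam a, UWittPos.isNoetherianRing_range_lam_op a⟩,
    UWittPos.ker_phi k⟩
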